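/- **Conventions.** The colours are $Col=\{0_+,0_-,1,2,\dots\}$. Fix a field $K$. A planar algebra $P$ over $K$ consists of a $K$-vector space $P_n$ for each $n\in Col$ and, for each (shaded, starred) planar tangle $T$ with external box of colour $n_0$ and internal boxes of colours $n_1,\dots,n_b$ ($b\ge 0$), of a multilinear map $Z_T^P:P_{n_1}\times\cdots\times P_{n_b}\to P_{n_0}$ that depends only on $T$ up to planar isotopy. These maps are compatible with substitution of tangles and renumbering of internal boxes, and identity tangles act as identity maps. A planar algebra map $P\to Q$ is a family of linear maps $P_n\to Q_n$ that commutes with all $Z_T$; it is surjective if it is surjective in each colour. A planar ideal $J$ of $P$ is a family of subspaces $J_n\subseteq P_n$ such that $Z_T^P(x_1,\dots,x_b)\in J_{n_0}$ for every tangle $T$ as soon as some $x_i$ lies in $J_{n_i}$. It is finitely generated if it is the smallest planar ideal containing some finite subset of $\coprod_n P_n$. For a label set $L=\coprod_{n\in Col}L_n$, the universal planar algebra $P(L)$ has as $P(L)_n$ the vector space with basis the set of all $L$-labelled $n$-tangles (tangles whose internal boxes of colour $m$ carry labels from $L_m$) up to planar isotopy, regardless of the numbering of the boxes; tangles act on it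 by substitution. **Proposition 5.3.** Let $P$ be a planar algebra and suppose that for finite label sets $L$ and $\tilde L$ there are surjective planar algebra maps $\pi:P(L)\to P$ and $\tilde\pi:P(\tilde L)\to P$. Then $I=\ker(\pi)$ is a finitely generated planar ideal of $P(L)$ if and only if $\tilde I=\ker(\tilde\pi)$ is a finitely generated planar ideal of $P(\tilde L)$. -/

import Mathlib

open Set Filter Topology

noncomputable section

/-- The colours `0₊`, `0₋`, `1`, `2`, …: `zero false` is `0₊`, `zero true` is `0₋`, and
`succ n` is the positive colour `n + 1`. -/
inductive Colour : Type
  | zero (black : Bool)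
  | succ (n : ℕ)

namespace Colour

/-- The marked points on the unit circle of the model box of a given colour: the `2m`
points `z` with `z ^ (2 m) = 1` for a box of positive colour `m`, and none for a `0`-box. -/
def marked : Colour → Set ℂ
  | zero _ => ∅
  | succ n => {z | ‖z‖ = 1 ∧ (z ^ (n + 1)).im = 0}

/-- The open arcs of the boundary of the model box that touch black regions. For positive colour
`m` the `2m` arcs cut out by the marked points are alternately white and black, and the arc
`{exp (iθ) | 0 < θ < π / m}`, at which the `*` of the box is placed, is white. -/
def blackArc : Colour → Set ℂ
  | zero false => ∅
  | zero true => {z | ‖z‖ = 1}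
  | succ n => {z | ‖z‖ = 1 ∧ (z ^ (n + 1)).im < 0}

theorem norm_of_mem_marked {c : Colour} {z : ℂ} (h : z ∈ c.marked) : ‖z‖ = 1 := by
  cases c with
  | zero b => exact h.elim
  | succ n => exact h.1

theorem norm_of_mem_blackArc {c : Colour} {z : ℂ} (h : z ∈ c.blackArc) : ‖z‖ = 1 := by
  cases c with
  | zero b => cases b with
    | false => exact h.elim
    | true => exact h
  | succ n => exact h.1

theorem not_mem_marked_of_mem_blackArc {c : Colour} {z : ℂ} (h : z ∈ c.blackArc) :
    z ∉ c.marked := by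
  cases c with
  | zero b => exact fun h => h.elim
  | succ n => exact fun h' => h.2.ne h'.2

theorem finite_marked (c : Colour) : c.marked.Finite := by
  cases c with
  | zero b => exact Set.finite_empty
  | succ n =>
    have hf : (↑(Polynomial.nthRoots (2 * (n + 1)) (1 : ℂ)).toFinset : Set ℂ).Finite :=
      Finset.finite_toSet _
    refine hf.subset ?_
    rintro z ⟨h1, h2⟩
    simp only [Finset.mem_coe, Multiset.mem_toFinset]
    rw [Polynomial.mem_nthRoots (by omega), mul_comm, pow_mul]
    have h3 : ‖z ^ (n + 1)‖ = 1 := by simp [h1]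
    have h4 := Complex.sq_norm (z ^ (n + 1))
    rw [h3, Complex.normSq_apply, h2] at h4
    apply Complex.ext
    · rw [pow_two, Complex.mul_re, h2]; simp; nlinarith
    · rw [pow_two, Complex.mul_im, h2]; simp

theorem eventually_marked (c : Colour) (q : ℂ) : ∀ᶠ w in 𝓝 q, w ∈ c.marked → w = q := by
  have h : IsClosed (c.marked \ {q}) := (c.finite_marked.subset sdiff_subset).isClosed
  have : (c.marked \ {q})ᶜ ∈ 𝓝 q := h.isOpen_compl.mem_nhds (by simp)
  filter_upwards [this] with w hw hm
  by_contra hne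
  exact hw ⟨hm, hne⟩

end Colour

/-- A round disc in the plane with a similarity `z ↦ center + scale * z` from the closed unit disc
onto it. The marked points of the box and its `*` are the images of those of the model box. -/
structure Box where
  center : ℂ
  scale : ℂ
  scale_ne : scale ≠ 0

namespace Box

/-- The similarity `z ↦ center + scale * z` of a box. -/
def map (B : Box) (z : ℂ) : ℂ := B.center + B.scale * z

/-- The similarity of a box, as a homeomorphism of the plane. -/
def homeo (B : Box) : ℂ ≃ₜ ℂ :=
  (Homeomorph.mulLeft₀ B.scale B.scale_ne).trans (Homeomorph.addLeft B.center)

theorem homeo_apply (B : Box) (z : ℂ) : B.homeo z = B.map z := rfl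

theorem map_inj (B : Box) {z w : ℂ} : B.map z = B.map w ↔ z = w := B.homeo.injective.eq_iff

theorem continuous_map (B : Box) : Continuous B.map := B.homeo.continuous

theorem exists_map (B : Box) (p : ℂ) : ∃ z, B.map z = p := B.homeo.surjective p

theorem eventually_map (B : Box) {z : ℂ} {P : ℂ → Prop} :
    (∀ᶠ x in 𝓝 (B.map z), P x) ↔ ∀ᶠ y in 𝓝 z, P (B.map y) := by
  rw [← B.homeo_apply, ← B.homeo.map_nhds_eq]; rfl

/-- A box placed inside a box. -/
def comp (B B' : Box) : Box where
  center := B.map B'.center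
  scale := B.scale * B'.scale
  scale_ne := mul_ne_zero B.scale_ne B'.scale_ne

theorem comp_map (B B' : Box) (z : ℂ) : (B.comp B').map z = B.map (B'.map z) := by
  simp only [comp, map]; ring

theorem norm_map_le (B : Box) (z : ℂ) : ‖B.map z‖ ≤ ‖B.center‖ + ‖B.scale‖ * ‖z‖ := by
  unfold map
  exact (norm_add_le _ _).trans (by rw [norm_mul])

theorem isClosed_closed (B : Box) : IsClosed (B.map '' {z | ‖z‖ ≤ 1}) :=
  B.homeo.isClosedMap _ (isClosed_le continuous_norm continuous_const)

theorem isOpen_open (B : Box) : IsOpen (B.map '' {z | ‖z‖ < 1}) :=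
  B.homeo.isOpenMap _ (isOpen_lt continuous_norm continuous_const)

end Box

/-- `C` is a one-dimensional manifold at `p`, not a boundary point: some arc contained in `C`
with `p` in its interior is a neighbourhood of `p` in `C`. -/
def IsArcPoint (C : Set ℂ) (p : ℂ) : Prop :=
  ∃ γ : ℝ → ℂ, ContinuousOn γ (Icc (-1) 1) ∧ InjOn γ (Icc (-1) 1) ∧ γ 0 = p ∧
    γ '' Icc (-1) 1 ⊆ C ∧ γ '' Icc (-1) 1 ∈ 𝓝[C] p

theorem IsArcPoint.of_eventually {C C' : Set ℂ} {p : ℂ} (h : IsArcPoint C p)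
    (h1 : C ⊆ C') (h2 : ∀ᶠ x in 𝓝 p, x ∈ C' → x ∈ C) : IsArcPoint C' p := by
  obtain ⟨γ, a, b, c, d, e⟩ := h
  refine ⟨γ, a, b, c, d.trans h1, ?_⟩
  rw [mem_nhdsWithin_iff_eventually] at e ⊢
  filter_upwards [e, h2] with x h3 h4 h5 using h3 (h4 h5)

theorem IsArcPoint.image {C : Set ℂ} {p : ℂ} (h : IsArcPoint C p) (B : Box) :
    IsArcPoint (B.map '' C) (B.map p) := by
  obtain ⟨γ, a, b, c, d, e⟩ := h
  refine ⟨fun t => B.map (γ t), B.continuous_map.comp_continuousOn a, ?_, by simp [c], ?_, ?_⟩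
  · intro x hx y hy hxy
    exact b hx hy (B.map_inj.1 hxy)
  · rintro _ ⟨t, ht, rfl⟩
    exact ⟨_, d ⟨t, ht, rfl⟩, rfl⟩
  · rw [mem_nhdsWithin_iff_eventually] at e ⊢
    rw [B.eventually_map]
    filter_upwards [e] with x h3 h5
    obtain ⟨y, hy, hxy⟩ := h5
    rw [B.map_inj] at hxy
    subst hxy
    obtain ⟨t, ht, rfl⟩ := h3 hy
    exact ⟨t, ht, rfl⟩

theorem isArcPoint_radial {C : Set ℂ} (B : Box) {q : ℂ} (hq : ‖q‖ = 1)
    (h1 : ∀ᶠ r : ℝ in 𝓝 1, B.map (r * q) ∈ C)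
    (h2 : ∀ᶠ x in 𝓝 q, B.map x ∈ C → x / ‖x‖ = q) : IsArcPoint C (B.map q) := by
  have hq0 : q ≠ 0 := by rintro rfl; simp at hq
  obtain ⟨δ, hδ, hball⟩ := Metric.eventually_nhds_iff.1 h1
  set η := min (δ / 2) (1 / 2) with hη
  have hη0 : 0 < η := by positivity
  have hη1 : η ≤ 1 / 2 := min_le_right _ _
  have hηδ : η ≤ δ / 2 := min_le_left _ _
  refine ⟨fun t => B.map (((1 + t * η : ℝ) : ℂ) * q), ?_, ?_, by simp, ?_, ?_⟩
  · refine (B.continuous_map.comp ?_).continuousOn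
    fun_prop
  · intro x hx y hy hxy
    have := B.map_inj.1 hxy
    have := mul_right_cancel₀ hq0 this
    have h3 : (1 + x * η : ℝ) = 1 + y * η := by exact_mod_cast this
    nlinarith [mul_right_cancel₀ hη0.ne' (by linarith : x * η = y * η)]
  · rintro _ ⟨t, ht, rfl⟩
    apply hball
    rw [Real.dist_eq, add_sub_cancel_left, abs_mul, abs_of_pos hη0]
    have : |t| ≤ 1 := abs_le.2 ht
    nlinarith
  · rw [mem_nhdsWithin_iff_eventually, B.eventually_map]
    have h3 : ∀ᶠ x in 𝓝 q, |‖x‖ - 1| < η := by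
      have : Tendsto (fun x : ℂ => |‖x‖ - 1|) (𝓝 q) (𝓝 0) := by
        have : Continuous (fun x : ℂ => |‖x‖ - 1|) := by fun_prop
        simpa [hq] using this.tendsto q
      exact this.eventually (gt_mem_nhds hη0)
    filter_upwards [h2, h3] with x hx1 hx2 hx
    have hx3 := hx1 hx
    have hx0 : (‖x‖ : ℂ) ≠ 0 := by
      rintro h0
      rw [h0, div_zero] at hx3
      exact hq0 hx3.symm
    refine ⟨(‖x‖ - 1) / η, ?_, ?_⟩
    · rw [abs_lt] at hx2
      constructor
      · rw [le_div_iff₀ hη0]; linarith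
      · rw [div_le_iff₀ hη0]; linarith
    · simp only
      rw [div_mul_cancel₀ _ hη0.ne', ← hx3]
      congr 1
      push_cast
      field_simp
      ring

/-- The part of the closed unit disc that lies outside the open boxes and off the curves `C`.
Its connected components are the regions. -/
def surface {ι : Type} (box : ι → Box) (C : Set ℂ) : Set ℂ :=
  {p | ‖p‖ ≤ 1 ∧ p ∉ C ∧ ∀ i z, ‖z‖ < 1 → (box i).map z ≠ p}

/-- A planar tangle with external box of colour `c₀` and internal boxes `D i`, `i : ι`, of colours
`c i`. The external box is the closed unit disc, the internal boxes are disjoint round discs in its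
interior, and the strings meet the boxes radially; every tangle can be brought into this form by a
planar isotopy.

* `curves` is the union of all the strings, open and closed. It is a compact one-dimensional
  submanifold of the surface obtained from the external disc by removing the interiors
  of the internal boxes, and its boundary points are the marked points of all the boxes.
* `black` is the union of the black regions, which include the parts of the boundaries
  of the boxes that they touch; the other points of the surface off the curves are white. -/
structure Tangle {ι : Type} (c₀ : Colour) (c : ι → Colour) where
  box : ι → Box
  curves : Set ℂ
  black : Set ℂ
  box_inside : ∀ i, ‖(box i).center‖ + ‖(box i).scale‖ < 1
  box_disjoint : ∀ i j, i ≠ j → ∀ z w, ‖z‖ ≤ 1 → ‖w‖ ≤ 1 → (box i).map z ≠ (box j).map w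
  isClosed_curves : IsClosed curves
  curves_inside : ∀ p ∈ curves, ‖p‖ ≤ 1
  curves_outside : ∀ i z, ‖z‖ < 1 → (box i).map z ∉ curves
  /-- Off the boundaries of the boxes, `curves` is a manifold without boundary. -/
  isArcPoint : ∀ p ∈ curves, ‖p‖ < 1 → (∀ i z, ‖z‖ ≤ 1 → (box i).map z ≠ p) → IsArcPoint curves p
  /-- Strings meet the external box precisely in the marked points, and radially. -/
  outer_curves : ∀ᶠ r : ℝ in 𝓝[≤] (1 : ℝ), ∀ z : ℂ, ‖z‖ = 1 → (r * z ∈ curves ↔ z ∈ c₀.marked)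
  /-- Strings meet each internal box precisely in the marked points, and radially. -/
  inner_curves : ∀ i, ∀ᶠ r : ℝ in 𝓝[≥] (1 : ℝ), ∀ z : ℂ, ‖z‖ = 1 →
    ((box i).map (r * z) ∈ curves ↔ z ∈ (c i).marked)
  black_subset : black ⊆ surface box curves
  /-- The shading is locally constant off the curves: each region is either black or white. -/
  locallyConst : ∀ p ∈ surface box curves, ∀ᶠ q in 𝓝 p, q ∈ surface box curves →
    (q ∈ black ↔ p ∈ black)
  /-- The shading is chequerboard: every string has black on one side ... -/
  curves_black : curves ⊆ closure black
  /-- ... and white on the other. -/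
  curves_white : curves ⊆ closure (surface box curves \ black)
  /-- The shading along the external box is the one prescribed by its `*` or its sign. -/
  outer_black : ∀ᶠ r : ℝ in 𝓝[≤] (1 : ℝ), ∀ z : ℂ, ‖z‖ = 1 → (r * z ∈ black ↔ z ∈ c₀.blackArc)
  /-- The shading along each internal box is the one prescribed by its `*` or its sign. -/
  inner_black : ∀ i, ∀ᶠ r : ℝ in 𝓝[≥] (1 : ℝ), ∀ z : ℂ, ‖z‖ = 1 →
    ((box i).map (r * z) ∈ black ↔ z ∈ (c i).blackArc)

/-- The union of a set `X` and of copies of the sets `Y i` placed in the boxes. -/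
def glue {ι : Type} (box : ι → Box) (X : Set ℂ) (Y : ι → Set ℂ) : Set ℂ :=
  X ∪ ⋃ i, (box i).map '' Y i

theorem mem_glue {ι : Type} {box : ι → Box} {X : Set ℂ} {Y : ι → Set ℂ} {p : ℂ} :
    p ∈ glue box X Y ↔ p ∈ X ∨ ∃ i, ∃ z ∈ Y i, (box i).map z = p := by
  simp [glue]

theorem mem_glue_in {ι : Type} {box : ι → Box} {X : Set ℂ} {Y : ι → Set ℂ}
    (hd : ∀ i j, i ≠ j → ∀ z w, ‖z‖ ≤ 1 → ‖w‖ ≤ 1 → (box i).map z ≠ (box j).map w)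
    (hX : ∀ i z, ‖z‖ < 1 → (box i).map z ∉ X)
    (hY : ∀ i, ∀ z ∈ Y i, ‖z‖ ≤ 1)
    (hXY : ∀ i z, ‖z‖ = 1 → ((box i).map z ∈ X ↔ z ∈ Y i))
    {i : ι} {z : ℂ} (hz : ‖z‖ ≤ 1) : (box i).map z ∈ glue box X Y ↔ z ∈ Y i := by
  rw [mem_glue]
  constructor
  · rintro (h | ⟨j, w, hw, h⟩)
    · rcases hz.lt_or_eq with h' | h'
      · exact (hX _ _ h' h).elim
      · exact (hXY _ _ h').1 h
    · by_cases hij : j = i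
      · subst hij
        rw [Box.map_inj] at h
        exact h ▸ hw
      · exact (hd _ _ hij _ _ (hY _ _ hw) hz h).elim
  · exact fun h => Or.inr ⟨i, z, h, rfl⟩

theorem mem_glue_out {ι : Type} {box : ι → Box} {X : Set ℂ} {Y : ι → Set ℂ}
    (hY : ∀ i, ∀ z ∈ Y i, ‖z‖ ≤ 1)
    (hXY : ∀ i z, ‖z‖ = 1 → ((box i).map z ∈ X ↔ z ∈ Y i))
    {p : ℂ} (hp : ∀ i z, ‖z‖ < 1 → (box i).map z ≠ p) : p ∈ glue box X Y ↔ p ∈ X := by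
  rw [mem_glue]
  constructor
  · rintro (h | ⟨j, w, hw, rfl⟩)
    · exact h
    · rcases (hY _ _ hw).lt_or_eq with h' | h'
      · exact (hp _ _ h' rfl).elim
      · exact (hXY _ _ h').2 hw
  · exact Or.inl

namespace Tangle

section basic

variable {ι : Type} {c₀ : Colour} {c : ι → Colour} (T : Tangle c₀ c)

theorem outer_marked {z : ℂ} (hz : ‖z‖ = 1) : z ∈ T.curves ↔ z ∈ c₀.marked := by
  have := T.outer_curves.self_of_nhdsWithin (by simp) z hz
  simpa using this

theorem inner_marked (i : ι) {z : ℂ} (hz : ‖z‖ = 1) :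
    (T.box i).map z ∈ T.curves ↔ z ∈ (c i).marked := by
  have := (T.inner_curves i).self_of_nhdsWithin (by simp) z hz
  simpa using this

theorem outer_shade {z : ℂ} (hz : ‖z‖ = 1) : z ∈ T.black ↔ z ∈ c₀.blackArc := by
  have := T.outer_black.self_of_nhdsWithin (by simp) z hz
  simpa using this

theorem inner_shade (i : ι) {z : ℂ} (hz : ‖z‖ = 1) :
    (T.box i).map z ∈ T.black ↔ z ∈ (c i).blackArc := by
  have := (T.inner_black i).self_of_nhdsWithin (by simp) z hz
  simpa using this

theorem norm_box_lt (i : ι) {z : ℂ} (hz : ‖z‖ ≤ 1) : ‖(T.box i).map z‖ < 1 := by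
  have h1 := (T.box i).norm_map_le z
  have h2 := T.box_inside i
  have h3 := norm_nonneg (T.box i).scale
  nlinarith

theorem eventually_out [Finite ι] {p : ℂ} {s : Set ι} (hp : ∀ i ∈ s, ∀ z, ‖z‖ ≤ 1 → (T.box i).map z ≠ p) :
    ∀ᶠ q in 𝓝 p, ∀ i ∈ s, ∀ z, ‖z‖ ≤ 1 → (T.box i).map z ≠ q := by
  rw [Filter.eventually_all]
  intro i
  by_cases hi : i ∈ s
  · have : ((T.box i).map '' {z | ‖z‖ ≤ 1})ᶜ ∈ 𝓝 p := by
      refine (T.box i).isClosed_closed.isOpen_compl.mem_nhds ?_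
      rintro ⟨z, hz, h⟩
      exact hp i hi z hz h
    filter_upwards [this] with q hq _ z hz h
    exact hq ⟨z, hz, h⟩
  · exact Eventually.of_forall fun q h => (hi h).elim

theorem eventually_collar [Finite ι] : ∀ᶠ r : ℝ in 𝓝[≤] (1 : ℝ), ∀ z : ℂ, ‖z‖ = 1 →
    ∀ i w, ‖w‖ < 1 → (T.box i).map w ≠ r * z := by
  have h : ∀ i, ∀ᶠ r : ℝ in 𝓝[≤] (1 : ℝ), ‖(T.box i).center‖ + ‖(T.box i).scale‖ < r := fun i =>
    mem_nhdsWithin_of_mem_nhds (lt_mem_nhds (T.box_inside i))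
  have h0 : ∀ᶠ r : ℝ in 𝓝[≤] (1 : ℝ), 0 < r := mem_nhdsWithin_of_mem_nhds (lt_mem_nhds one_pos)
  filter_upwards [Filter.eventually_all.2 h, h0] with r hr' hr0 z hz i w hw hw'
  have h1 := (T.box i).norm_map_le w
  have h2 := hr' i
  have h3 := norm_nonneg (T.box i).scale
  rw [hw', norm_mul, hz, Complex.norm_real, Real.norm_of_nonneg hr0.le] at h1
  nlinarith

theorem eventually_inside (i : ι) : ∀ᶠ r : ℝ in 𝓝[≥] (1 : ℝ), ∀ z : ℂ, ‖z‖ = 1 →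
    ‖(T.box i).map (r * z)‖ < 1 := by
  apply mem_nhdsWithin_of_mem_nhds
  have h : Tendsto (fun r : ℝ => ‖(T.box i).center‖ + ‖(T.box i).scale‖ * |r|) (𝓝 1)
      (𝓝 (‖(T.box i).center‖ + ‖(T.box i).scale‖)) := by
    have : Continuous (fun r : ℝ => ‖(T.box i).center‖ + ‖(T.box i).scale‖ * |r|) := by fun_prop
    simpa using this.tendsto 1
  filter_upwards [h.eventually (gt_mem_nhds (T.box_inside i))] with r hr z hz
  refine ((T.box i).norm_map_le _).trans_lt ?_
  rw [norm_mul, hz, mul_one, Complex.norm_real]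
  exact hr

end basic

section comp

variable {ι : Type} {κ : ι → Type} {c₀ : Colour} {c : ι → Colour}
  {d : ∀ i, κ i → Colour} (T : Tangle c₀ c) (S : ∀ i, Tangle (c i) (d i))

theorem glue_curves_in {i : ι} {z : ℂ} (hz : ‖z‖ ≤ 1) :
    (T.box i).map z ∈ glue T.box T.curves (fun i => (S i).curves) ↔ z ∈ (S i).curves :=
  mem_glue_in T.box_disjoint T.curves_outside (fun i => (S i).curves_inside)
    (fun i _ hz => (T.inner_marked i hz).trans ((S i).outer_marked hz).symm) hz

theorem glue_curves_out {p : ℂ} (hp : ∀ i z, ‖z‖ < 1 → (T.box i).map z ≠ p) :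
    p ∈ glue T.box T.curves (fun i => (S i).curves) ↔ p ∈ T.curves :=
  mem_glue_out (fun i => (S i).curves_inside)
    (fun i _ hz => (T.inner_marked i hz).trans ((S i).outer_marked hz).symm) hp

theorem glue_black_in {i : ι} {z : ℂ} (hz : ‖z‖ ≤ 1) :
    (T.box i).map z ∈ glue T.box T.black (fun i => (S i).black) ↔ z ∈ (S i).black :=
  mem_glue_in T.box_disjoint (fun i z hz h => (T.black_subset h).2.2 i z hz rfl)
    (fun i _ hz => ((S i).black_subset hz).1)
    (fun i _ hz => (T.inner_shade i hz).trans ((S i).outer_shade hz).symm) hz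

theorem glue_black_out {p : ℂ} (hp : ∀ i z, ‖z‖ < 1 → (T.box i).map z ≠ p) :
    p ∈ glue T.box T.black (fun i => (S i).black) ↔ p ∈ T.black :=
  mem_glue_out (fun i _ hz => ((S i).black_subset hz).1)
    (fun i _ hz => (T.inner_shade i hz).trans ((S i).outer_shade hz).symm) hp

theorem glue_surface {p : ℂ} :
    p ∈ surface (fun x : Σ i, κ i => (T.box x.1).comp ((S x.1).box x.2))
      (glue T.box T.curves (fun i => (S i).curves)) ↔
    p ∈ surface T.box T.curves ∨
      ∃ i, ∃ z ∈ surface (S i).box (S i).curves, (T.box i).map z = p := by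
  constructor
  · rintro ⟨h1, h2, h3⟩
    by_cases hp : ∀ i z, ‖z‖ < 1 → (T.box i).map z ≠ p
    · exact Or.inl ⟨h1, fun h => h2 ((T.glue_curves_out S hp).2 h), hp⟩
    · push Not at hp
      obtain ⟨i, z, hz, rfl⟩ := hp
      refine Or.inr ⟨i, z, ⟨hz.le, fun h => h2 ((T.glue_curves_in S hz.le).2 h), ?_⟩, rfl⟩
      rintro j w hw rfl
      exact h3 ⟨i, j⟩ w hw (Box.comp_map _ _ _)
  · rintro (⟨h1, h2, h3⟩ | ⟨i, z, ⟨h1, h2, h3⟩, rfl⟩)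
    · refine ⟨h1, fun h => h2 ((T.glue_curves_out S h3).1 h), ?_⟩
      rintro ⟨i, j⟩ z hz h
      rw [Box.comp_map] at h
      exact h3 i _ ((S i).norm_box_lt j hz.le) h
    · refine ⟨(T.norm_box_lt i h1).le, fun h => h2 ((T.glue_curves_in S h1).1 h), ?_⟩
      rintro ⟨i', j⟩ w hw h
      simp only [Box.comp_map] at h
      have h4 := (S i').norm_box_lt j hw.le
      by_cases hi : i' = i
      · subst hi
        rw [Box.map_inj] at h
        exact h3 _ _ hw h
      · exact T.box_disjoint _ _ hi _ _ h4.le h1 h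

theorem glue_arc [Finite ι] {p : ℂ} (hp : p ∈ glue T.box T.curves (fun i => (S i).curves)) (hp1 : ‖p‖ < 1)
    (hp2 : ∀ (x : Σ i, κ i) z, ‖z‖ ≤ 1 → ((T.box x.1).comp ((S x.1).box x.2)).map z ≠ p) :
    IsArcPoint (glue T.box T.curves (fun i => (S i).curves)) p := by
  by_cases h : ∀ i z, ‖z‖ ≤ 1 → (T.box i).map z ≠ p
  · have h' := fun i z (hz : ‖z‖ < 1) => h i z hz.le
    rw [T.glue_curves_out S h'] at hp
    refine (T.isArcPoint p hp hp1 h).of_eventually subset_union_left ?_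
    have := T.eventually_out (s := univ) (fun i _ => h i)
    filter_upwards [this] with q hq hq'
    exact (T.glue_curves_out S (fun i z hz => hq i trivial z hz.le)).1 hq'
  push Not at h
  obtain ⟨i, q, hq, rfl⟩ := h
  have hC : (T.box i).map '' (S i).curves ⊆ glue T.box T.curves (fun i => (S i).curves) := by
    rintro _ ⟨w, hw, rfl⟩
    exact mem_glue.2 (Or.inr ⟨i, w, hw, rfl⟩)
  rw [T.glue_curves_in S hq] at hp
  rcases hq.lt_or_eq with hq | hq
  · have h1 : IsArcPoint (S i).curves q := by
      refine (S i).isArcPoint q hp hq ?_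
      rintro j z hz rfl
      exact hp2 ⟨i, j⟩ z hz (Box.comp_map _ _ _)
    refine (h1.image (T.box i)).of_eventually hC ?_
    rw [Box.eventually_map]
    have : ∀ᶠ y in 𝓝 q, ‖y‖ < 1 := continuous_norm.continuousAt.eventually (gt_mem_nhds hq)
    filter_upwards [this] with y hy hy'
    exact ⟨y, (T.glue_curves_in S hy.le).1 hy', rfl⟩
  have hm : q ∈ (c i).marked := ((S i).outer_marked hq).1 hp
  have hcol : ∀ᶠ r : ℝ in 𝓝 1, (r ≤ 1 → ∀ z : ℂ, ‖z‖ = 1 → (r * z ∈ (S i).curves ↔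
      z ∈ (c i).marked)) ∧ (1 ≤ r → ∀ z : ℂ, ‖z‖ = 1 →
        ((T.box i).map (r * z) ∈ T.curves ↔ z ∈ (c i).marked)) := by
    have h1 := eventually_nhdsWithin_iff.1 (S i).outer_curves
    have h2 := eventually_nhdsWithin_iff.1 (T.inner_curves i)
    exact h1.and h2
  refine isArcPoint_radial (T.box i) hq ?_ ?_
  · filter_upwards [hcol] with r hr
    rcases le_total r 1 with h | h
    · exact hC ⟨_, (hr.1 h q hq).2 hm, rfl⟩
    · exact Or.inl ((hr.2 h q hq).2 hm)
  · have hq0 : q ≠ 0 := by rintro rfl; simp at hq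
    have t1 : Tendsto (fun x : ℂ => ‖x‖) (𝓝 q) (𝓝 1) := by
      simpa [hq] using continuous_norm.tendsto q
    have t2 : Tendsto (fun x : ℂ => x / (‖x‖ : ℂ)) (𝓝 q) (𝓝 q) := by
      have : ContinuousAt (fun x : ℂ => x / (‖x‖ : ℂ)) q :=
        continuousAt_id.div (by fun_prop) (by simpa using hq0)
      simpa [ContinuousAt, hq] using this
    have h3 := T.eventually_out (s := {j | j ≠ i}) (p := (T.box i).map q)
      (fun j hj z hz => T.box_disjoint j i hj z q hz hq.le)
    rw [Box.eventually_map] at h3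
    have h4 : ∀ᶠ x in 𝓝 q, x ≠ 0 := isOpen_ne.mem_nhds hq0
    filter_upwards [t1.eventually hcol, t2.eventually ((c i).eventually_marked q), h3, h4]
      with x hx1 hx2 hx3 hx0 hx
    apply hx2
    have e : (‖x‖ : ℂ) * (x / ‖x‖) = x := by
      have : (‖x‖ : ℂ) ≠ 0 := by simpa using hx0
      field_simp
    have e1 : ‖x / (‖x‖ : ℂ)‖ = 1 := by
      have : ‖x‖ ≠ 0 := by simpa using hx0
      simp [this]
    rcases le_or_gt ‖x‖ 1 with h | h
    · rw [← hx1.1 h _ e1, e]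
      exact (T.glue_curves_in S h).1 hx
    · rw [← hx1.2 h.le _ e1, e]
      refine (T.glue_curves_out S ?_).1 hx
      intro j z hz hz'
      by_cases hj : j = i
      · subst hj
        rw [Box.map_inj] at hz'
        rw [hz'] at hz
        exact lt_asymm hz h
      · exact hx3 j hj z hz.le hz'

theorem glue_locallyConst [Finite ι] {p : ℂ}
    (hp : p ∈ surface (fun x : Σ i, κ i => (T.box x.1).comp ((S x.1).box x.2))
      (glue T.box T.curves (fun i => (S i).curves))) :
    ∀ᶠ q in 𝓝 p, q ∈ surface (fun x : Σ i, κ i => (T.box x.1).comp ((S x.1).box x.2))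
      (glue T.box T.curves (fun i => (S i).curves)) →
      (q ∈ glue T.box T.black (fun i => (S i).black) ↔
        p ∈ glue T.box T.black (fun i => (S i).black)) := by
  have h1 : ∀ᶠ q in 𝓝 p, q ∈ surface T.box T.curves →
      (q ∈ glue T.box T.black (fun i => (S i).black) ↔
        p ∈ glue T.box T.black (fun i => (S i).black)) := by
    by_cases h : ∀ i z, ‖z‖ < 1 → (T.box i).map z ≠ p
    · have h2 : p ∈ surface T.box T.curves :=
        ⟨hp.1, fun h' => hp.2.1 (Or.inl h'), h⟩
      filter_upwards [T.locallyConst p h2] with q hq hq'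
      rw [T.glue_black_out S h, T.glue_black_out S hq'.2.2]
      exact hq hq'
    · push Not at h
      obtain ⟨i, z, hz, rfl⟩ := h
      have : (T.box i).map '' {z | ‖z‖ < 1} ∈ 𝓝 ((T.box i).map z) :=
        (T.box i).isOpen_open.mem_nhds ⟨z, hz, rfl⟩
      filter_upwards [this] with q hq hq'
      obtain ⟨w, hw, rfl⟩ := hq
      exact (hq'.2.2 i w hw rfl).elim
  have h2 : ∀ i, ∀ᶠ q in 𝓝 p, ∀ z ∈ surface (S i).box (S i).curves, (T.box i).map z = q →
      (q ∈ glue T.box T.black (fun i => (S i).black) ↔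
        p ∈ glue T.box T.black (fun i => (S i).black)) := by
    intro i
    by_cases h : ∃ z, ‖z‖ ≤ 1 ∧ (T.box i).map z = p
    · obtain ⟨z, hz, rfl⟩ := h
      have h3 : z ∈ surface (S i).box (S i).curves := by
        refine ⟨hz, fun h' => hp.2.1 ((T.glue_curves_in S hz).2 h'), ?_⟩
        rintro j w hw rfl
        exact hp.2.2 ⟨i, j⟩ w hw (Box.comp_map _ _ _)
      rw [Box.eventually_map]
      filter_upwards [(S i).locallyConst z h3] with q hq w hw hw'
      rw [Box.map_inj] at hw'
      subst hw'
      rw [T.glue_black_in S hz, T.glue_black_in S hw.1]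
      exact hq hw
    · have : ((T.box i).map '' {z | ‖z‖ ≤ 1})ᶜ ∈ 𝓝 p :=
        (T.box i).isClosed_closed.isOpen_compl.mem_nhds (by simpa using h)
      filter_upwards [this] with q hq z hz hz'
      exact (hq ⟨z, hz.1, hz'⟩).elim
  filter_upwards [h1, Filter.eventually_all.2 h2] with q hq1 hq2 hq
  rcases (T.glue_surface S).1 hq with h | ⟨i, z, hz, hz'⟩
  · exact hq1 h
  · exact hq2 i z hz hz'

end comp

/-- Substitution: the tangle `S i` is placed in the box `D i` of `T`, for each `i`. The boxes of the
result are the boxes of all the `S i`. -/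
def comp {ι : Type} [Finite ι] {κ : ι → Type} {c₀ : Colour} {c : ι → Colour}
    {d : ∀ i, κ i → Colour} (T : Tangle c₀ c) (S : ∀ i, Tangle (c i) (d i)) :
    Tangle c₀ (fun x : Σ i, κ i => d x.1 x.2) where
  box x := (T.box x.1).comp ((S x.1).box x.2)
  curves := glue T.box T.curves (fun i => (S i).curves)
  black := glue T.box T.black (fun i => (S i).black)
  box_inside := by
    rintro ⟨i, j⟩
    have h1 := T.box_inside i
    have h2 := (S i).box_inside j
    have h3 : ‖((T.box i).comp ((S i).box j)).center‖ ≤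
        ‖(T.box i).center‖ + ‖(T.box i).scale‖ * ‖((S i).box j).center‖ :=
      (T.box i).norm_map_le _
    have h4 : ‖((T.box i).comp ((S i).box j)).scale‖ =
        ‖(T.box i).scale‖ * ‖((S i).box j).scale‖ := norm_mul _ _
    have h5 := norm_nonneg (T.box i).scale
    simp only
    nlinarith
  box_disjoint := by
    rintro ⟨i, j⟩ ⟨i', j'⟩ hne z w hz hw h
    simp only [Box.comp_map] at h
    by_cases hi : i = i'
    · subst hi
      rw [Box.map_inj] at h
      exact (S i).box_disjoint j j' (by rintro rfl; exact hne rfl) z w hz hw h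
    · exact T.box_disjoint i i' hi _ _ ((S i).norm_box_lt j hz).le ((S i').norm_box_lt j' hw).le h
  isClosed_curves := by
    refine T.isClosed_curves.union (isClosed_iUnion_of_finite fun i => ?_)
    exact (T.box i).homeo.isClosedMap _ (S i).isClosed_curves
  curves_inside := by
    intro p hp
    rcases mem_glue.1 hp with h | ⟨i, z, hz, rfl⟩
    · exact T.curves_inside p h
    · exact (T.norm_box_lt i ((S i).curves_inside z hz)).le
  curves_outside := by
    rintro ⟨i, j⟩ z hz h
    simp only [Box.comp_map] at h
    rw [T.glue_curves_in S ((S i).norm_box_lt j hz.le).le] at h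
    exact (S i).curves_outside j z hz h
  isArcPoint := fun p hp hp1 hp2 => T.glue_arc S hp hp1 hp2
  outer_curves := by
    filter_upwards [T.outer_curves, T.eventually_collar] with r hr hr' z hz
    rw [← hr z hz]
    exact T.glue_curves_out S (hr' z hz)
  inner_curves := by
    rintro ⟨i, j⟩
    filter_upwards [(S i).inner_curves j, (S i).eventually_inside j] with r hr hr' z hz
    rw [← hr z hz, Box.comp_map]
    exact T.glue_curves_in S (hr' z hz).le
  black_subset := by
    intro p hp
    rw [T.glue_surface S]
    rcases mem_glue.1 hp with h | ⟨i, z, hz, rfl⟩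
    · exact Or.inl (T.black_subset h)
    · exact Or.inr ⟨i, z, (S i).black_subset hz, rfl⟩
  locallyConst := fun p hp => T.glue_locallyConst S hp
  curves_black := by
    intro p hp
    rcases mem_glue.1 hp with h | ⟨i, z, hz, rfl⟩
    · exact closure_mono subset_union_left (T.curves_black h)
    · have h1 : (T.box i).map z ∈ closure ((T.box i).map '' (S i).black) :=
        image_closure_subset_closure_image (T.box i).continuous_map ⟨z, (S i).curves_black hz, rfl⟩
      refine closure_mono ?_ h1
      rintro _ ⟨w, hw, rfl⟩
      exact mem_glue.2 (Or.inr ⟨i, w, hw, rfl⟩)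
  curves_white := by
    intro p hp
    rcases mem_glue.1 hp with h | ⟨i, z, hz, rfl⟩
    · refine closure_mono ?_ (T.curves_white h)
      rintro q ⟨hq, hq'⟩
      exact ⟨(T.glue_surface S).2 (Or.inl hq), fun h => hq' ((T.glue_black_out S hq.2.2).1 h)⟩
    · have h1 : (T.box i).map z ∈
          closure ((T.box i).map '' (surface (S i).box (S i).curves \ (S i).black)) :=
        image_closure_subset_closure_image (T.box i).continuous_map ⟨z, (S i).curves_white hz, rfl⟩
      refine closure_mono ?_ h1
      rintro _ ⟨w, ⟨hw, hw'⟩, rfl⟩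
      exact ⟨(T.glue_surface S).2 (Or.inr ⟨i, w, hw, rfl⟩),
        fun h => hw' ((T.glue_black_in S hw.1).1 h)⟩
  outer_black := by
    filter_upwards [T.outer_black, T.eventually_collar] with r hr hr' z hz
    rw [← hr z hz]
    exact T.glue_black_out S (hr' z hz)
  inner_black := by
    rintro ⟨i, j⟩
    filter_upwards [(S i).inner_black j, (S i).eventually_inside j] with r hr hr' z hz
    rw [← hr z hz, Box.comp_map]
    exact T.glue_black_in S (hr' z hz).le

/-- Renumbering of the internal boxes. -/
def reindex {ι κ : Type} {c₀ : Colour} {c : ι → Colour} (T : Tangle c₀ c) (e : κ ≃ ι) :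
    Tangle c₀ (fun j => c (e j)) where
  box j := T.box (e j)
  curves := T.curves
  black := T.black
  box_inside j := T.box_inside (e j)
  box_disjoint i j h := T.box_disjoint (e i) (e j) (fun h' => h (e.injective h'))
  isClosed_curves := T.isClosed_curves
  curves_inside := T.curves_inside
  curves_outside j := T.curves_outside (e j)
  isArcPoint p hp h1 h2 := T.isArcPoint p hp h1 (e.forall_congr_right.1 h2)
  outer_curves := T.outer_curves
  inner_curves j := T.inner_curves (e j)
  black_subset p hp := ⟨(T.black_subset hp).1, (T.black_subset hp).2.1,
    fun j => (T.black_subset hp).2.2 (e j)⟩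
  locallyConst := by
    have : surface (fun j => T.box (e j)) T.curves = surface T.box T.curves := by
      ext p
      simp only [surface, mem_ofPred_eq]
      rw [e.forall_congr_right (q := fun i => ∀ z, ‖z‖ < 1 → (T.box i).map z ≠ p)]
    rw [this]
    exact T.locallyConst
  curves_black := T.curves_black
  curves_white := by
    have : surface (fun j => T.box (e j)) T.curves = surface T.box T.curves := by
      ext p
      simp only [surface, mem_ofPred_eq]
      rw [e.forall_congr_right (q := fun i => ∀ z, ‖z‖ < 1 → (T.box i).map z ≠ p)]
    rw [this]
    exact T.curves_white
  outer_black := T.outer_black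
  inner_black j := T.inner_black (e j)

end Tangle

namespace Colour

theorem isClosed_marked (c : Colour) : IsClosed c.marked := c.finite_marked.isClosed

theorem eventually_blackArc (c : Colour) {u : ℂ} (hu : ‖u‖ = 1) (hm : u ∉ c.marked) :
    ∀ᶠ w in 𝓝 u, ‖w‖ = 1 → (w ∈ c.blackArc ↔ u ∈ c.blackArc) := by
  cases c with
  | zero b => cases b with
    | false => exact Eventually.of_forall fun w _ => Iff.rfl
    | true => exact Eventually.of_forall fun w hw => ⟨fun _ => hu, fun _ => hw⟩
  | succ n =>
    have h0 : (u ^ (n + 1)).im ≠ 0 := fun h => hm ⟨hu, h⟩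
    have hc : ContinuousAt (fun w : ℂ => (w ^ (n + 1)).im) u := by fun_prop
    rcases h0.lt_or_gt with h | h
    · filter_upwards [hc.eventually (gt_mem_nhds h)] with w hw hw1
      exact ⟨fun _ => ⟨hu, h⟩, fun _ => ⟨hw1, hw⟩⟩
    · filter_upwards [hc.eventually (lt_mem_nhds h)] with w hw hw1
      exact ⟨fun h' => (lt_asymm hw h'.2).elim, fun h' => (lt_asymm h h'.2).elim⟩

theorem marked_subset_closure (n : ℕ) {u : ℂ} (hu : u ∈ (succ n).marked) (s : ℝ)
    (hs : s = 1 ∨ s = -1) : u ∈ closure {w : ℂ | ‖w‖ = 1 ∧ 0 < s * (w ^ (n + 1)).im} := by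
  obtain ⟨h1, h2⟩ := hu
  have h3 : (u ^ (n + 1)).re = 1 ∨ (u ^ (n + 1)).re = -1 := by
    have h3 : ‖u ^ (n + 1)‖ = 1 := by simp [h1]
    have h4 := Complex.sq_norm (u ^ (n + 1))
    rw [h3, Complex.normSq_apply, h2] at h4
    have : ((u ^ (n + 1)).re - 1) * ((u ^ (n + 1)).re + 1) = 0 := by nlinarith
    rcases mul_eq_zero.1 this with h | h
    · exact Or.inl (by linarith)
    · exact Or.inr (by linarith)
  set t := (u ^ (n + 1)).re with ht
  have hst : s * t = 1 ∨ s * t = -1 := by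
    rcases hs with rfl | rfl <;> rcases h3 with h | h <;> rw [h] <;> norm_num
  have hst2 : (s * t) * (s * t) = 1 := by rcases hst with h | h <;> rw [h] <;> norm_num
  have hlim : Tendsto (fun x : ℝ => u * Complex.exp (((s * t * x : ℝ) : ℂ) * Complex.I))
      (𝓝[>] 0) (𝓝 u) := by
    have : Continuous (fun x : ℝ => u * Complex.exp (((s * t * x : ℝ) : ℂ) * Complex.I)) := by
      fun_prop
    have h := this.tendsto 0
    simp only [mul_zero, Complex.ofReal_zero, zero_mul, Complex.exp_zero, mul_one] at h
    exact h.mono_left nhdsWithin_le_nhds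
  refine mem_closure_of_tendsto hlim ?_
  have hpos : (0 : ℝ) < n + 1 := by positivity
  have h5 : ∀ᶠ x : ℝ in 𝓝[>] 0, x < Real.pi / (n + 1) :=
    mem_nhdsWithin_of_mem_nhds (gt_mem_nhds (div_pos Real.pi_pos hpos))
  filter_upwards [h5, self_mem_nhdsWithin] with x hx hx0
  have hx0 : 0 < x := hx0
  refine ⟨by simp only [norm_mul, h1, Complex.norm_exp_ofReal_mul_I, mul_one], ?_⟩
  have h6 : (u * Complex.exp (((s * t * x : ℝ) : ℂ) * Complex.I)) ^ (n + 1) =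
      u ^ (n + 1) * Complex.exp (((s * t * ((n + 1) * x) : ℝ) : ℂ) * Complex.I) := by
    rw [mul_pow, ← Complex.exp_nat_mul]
    congr 2
    push_cast
    ring
  rw [h6, Complex.mul_im, h2, Complex.exp_ofReal_mul_I_im, zero_mul, add_zero, ← ht, ← mul_assoc]
  have h7 : 0 < Real.sin ((n + 1) * x) := by
    refine Real.sin_pos_of_pos_of_lt_pi (by positivity) ?_
    rw [lt_div_iff₀ hpos] at hx
    linarith
  rcases hst with h | h
  · rw [h]; simpa using h7
  · rw [h]; simpa using h7

theorem marked_subset_black (c : Colour) : c.marked ⊆ closure c.blackArc := by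
  cases c with
  | zero b => exact fun u hu => hu.elim
  | succ n =>
    intro u hu
    refine closure_mono ?_ (marked_subset_closure n hu (-1) (Or.inr rfl))
    rintro w ⟨h1, h2⟩
    exact ⟨h1, by linarith⟩

theorem marked_subset_white (c : Colour) :
    c.marked ⊆ closure {w | ‖w‖ = 1 ∧ w ∉ c.marked ∧ w ∉ c.blackArc} := by
  cases c with
  | zero b => exact fun u hu => hu.elim
  | succ n =>
    intro u hu
    refine closure_mono ?_ (marked_subset_closure n hu 1 (Or.inl rfl))
    rintro w ⟨h1, h2⟩
    rw [one_mul] at h2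
    exact ⟨h1, fun h => h2.ne' h.2, fun h => lt_asymm h2 h.2⟩

end Colour

/-- The points of the annulus `1 / 2 ≤ ‖p‖ ≤ 1` on the radii through a subset of the unit circle. -/
def radial (A : Set ℂ) : Set ℂ := {p | 1 / 2 ≤ ‖p‖ ∧ ‖p‖ ≤ 1 ∧ p / ‖p‖ ∈ A}

theorem ofReal_mul_div_norm {r : ℝ} (hr : 0 < r) {z : ℂ} (hz : ‖z‖ = 1) :
    (r * z) / ((‖(r : ℂ) * z‖ : ℝ) : ℂ) = z := by
  rw [norm_mul, hz, mul_one, Complex.norm_real, Real.norm_of_nonneg hr.le]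
  have : (r : ℂ) ≠ 0 := by exact_mod_cast hr.ne'
  field_simp

theorem mul_mem_radial {A : Set ℂ} {r : ℝ} {z : ℂ} (hz : ‖z‖ = 1) (h1 : 1 / 2 ≤ r) (h2 : r ≤ 1) :
    (r : ℂ) * z ∈ radial A ↔ z ∈ A := by
  have h0 : 0 < r := by linarith
  unfold radial
  rw [mem_ofPred_eq, ofReal_mul_div_norm h0 hz]
  simp [hz, abs_of_pos h0, h2]
  intro _
  linarith

theorem norm_mul_div_norm {p : ℂ} (hp : p ≠ 0) : (‖p‖ : ℂ) * (p / ‖p‖) = p ∧ ‖p / (‖p‖ : ℂ)‖ = 1 := by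
  have h : ‖p‖ ≠ 0 := by simpa using hp
  have h' : (‖p‖ : ℂ) ≠ 0 := by exact_mod_cast h
  refine ⟨by field_simp, by simp [h]⟩

theorem tendsto_div_norm {q : ℂ} (hq : q ≠ 0) :
    Tendsto (fun x : ℂ => x / (‖x‖ : ℂ)) (𝓝 q) (𝓝 (q / ‖q‖)) := by
  have : ContinuousAt (fun x : ℂ => x / (‖x‖ : ℂ)) q :=
    continuousAt_id.div (by fun_prop) (by simpa using hq)
  exact this

theorem subset_closure_radial {A B : Set ℂ} (hB : ∀ z ∈ B, ‖z‖ = 1)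
    (h : A ⊆ closure B) : radial A ⊆ closure (radial B) := by
  rintro p ⟨h1, h2, h3⟩
  have hp : p ≠ 0 := by rintro rfl; norm_num at h1
  have h4 : (‖p‖ : ℂ) * (p / ‖p‖) ∈ closure ((fun w : ℂ => (‖p‖ : ℂ) * w) '' B) :=
    image_closure_subset_closure_image (by fun_prop) ⟨_, h h3, rfl⟩
  rw [(norm_mul_div_norm hp).1] at h4
  refine closure_mono ?_ h4
  rintro _ ⟨w, hw, rfl⟩
  exact (mul_mem_radial (hB w hw) h1 h2).2 hw

/-- The box of the identity tangles. -/
def halfBox : Box where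
  center := 0
  scale := 1 / 2
  scale_ne := by norm_num

theorem halfBox_map (z : ℂ) : halfBox.map z = 1 / 2 * z := by simp [halfBox, Box.map]

theorem norm_halfBox_map (z : ℂ) : ‖halfBox.map z‖ = 1 / 2 * ‖z‖ := by
  rw [halfBox_map, norm_mul]; norm_num

theorem mem_surface_half {C : Set ℂ} {p : ℂ} :
    p ∈ surface (fun _ : Unit => halfBox) C ↔ ‖p‖ ≤ 1 ∧ p ∉ C ∧ 1 / 2 ≤ ‖p‖ := by
  unfold surface
  simp only [mem_ofPred_eq, forall_const]
  refine and_congr_right fun h1 => and_congr_right fun h2 => ?_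
  constructor
  · intro h
    by_contra! h'
    refine h (2 * p) ?_ ?_
    · rw [norm_mul]; norm_num; linarith
    · rw [halfBox_map]; ring
  · rintro h z hz rfl
    rw [norm_halfBox_map] at h
    linarith

/-- The identity tangle of a colour: one internal box, concentric with the external one, each
marked point of which is joined to the corresponding point of the external box by a radius. -/
def idTangle (c : Colour) : Tangle c (fun _ : Unit => c) where
  box _ := halfBox
  curves := radial c.marked
  black := radial c.blackArc
  box_inside _ := by simp [halfBox]; norm_num
  box_disjoint i j h := (h (Subsingleton.elim i j)).elim
  isClosed_curves := by
    have h1 : IsClosed {p : ℂ | 1 / 2 ≤ ‖p‖ ∧ ‖p‖ ≤ 1} :=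
      (isClosed_le continuous_const continuous_norm).inter
        (isClosed_le continuous_norm continuous_const)
    have h2 : ContinuousOn (fun p : ℂ => p / (‖p‖ : ℂ)) {p : ℂ | 1 / 2 ≤ ‖p‖ ∧ ‖p‖ ≤ 1} := by
      intro p hp
      have hp0 : p ≠ 0 := by rintro rfl; have := hp.1; norm_num at this
      have : ContinuousAt (fun x : ℂ => x / (‖x‖ : ℂ)) p := tendsto_div_norm hp0
      exact this.continuousWithinAt
    have := h2.preimage_isClosed_of_isClosed h1 c.isClosed_marked
    convert this using 1
    ext p
    simp [radial, and_assoc]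
  curves_inside p hp := hp.2.1
  curves_outside i z hz h := by
    have := h.1
    rw [norm_halfBox_map] at this
    linarith
  isArcPoint := by
    rintro p ⟨h1, h2, h3⟩ h4 h5
    have hp : p ≠ 0 := by rintro rfl; norm_num at h1
    have h6 : 1 / 2 < ‖p‖ := by
      by_contra! h'
      refine h5 () (2 * p) ?_ ?_
      · rw [norm_mul]; norm_num; linarith
      · rw [halfBox_map]; ring
    have hp1 : ‖p‖ ≠ 0 := by simpa using hp
    have hp' : (‖p‖ : ℂ) ≠ 0 := by exact_mod_cast hp1
    obtain ⟨e1, e2⟩ := norm_mul_div_norm hp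
    let B : Box := ⟨0, (‖p‖ : ℂ), hp'⟩
    have hB : ∀ x, B.map x = ‖p‖ * x := fun x => by simp [B, Box.map]
    have h7 : IsArcPoint (radial c.marked) (B.map (p / ‖p‖)) := by
      refine isArcPoint_radial B e2 ?_ ?_
      · have t : Tendsto (fun r : ℝ => ‖p‖ * r) (𝓝 1) (𝓝 ‖p‖) := by
          have : Continuous (fun r : ℝ => ‖p‖ * r) := by fun_prop
          simpa using this.tendsto 1
        filter_upwards [t.eventually (lt_mem_nhds h6), t.eventually (gt_mem_nhds h4)] with r h8 h9
        have : B.map (r * (p / ‖p‖)) = ((‖p‖ * r : ℝ) : ℂ) * (p / ‖p‖) := by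
          rw [hB]; push_cast; ring
        rw [this, mul_mem_radial e2 h8.le h9.le]
        exact h3
      · have hq0 : p / (‖p‖ : ℂ) ≠ 0 := div_ne_zero hp hp'
        have t := tendsto_div_norm hq0
        rw [e2, Complex.ofReal_one, div_one] at t
        filter_upwards [t.eventually (c.eventually_marked _)] with x hx hx'
        refine hx ?_
        have h8 := hx'.2.2
        have : (‖B.map x‖ : ℂ) = ‖p‖ * ‖x‖ := by rw [hB, norm_mul]; simp
        rwa [this, hB, mul_div_mul_left _ _ hp'] at h8
    rwa [hB, e1] at h7
  outer_curves := by
    have : ∀ᶠ r : ℝ in 𝓝[≤] (1 : ℝ), 1 / 2 < r :=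
      mem_nhdsWithin_of_mem_nhds (lt_mem_nhds (by norm_num))
    filter_upwards [this, self_mem_nhdsWithin] with r h1 h2 z hz
    exact mul_mem_radial hz h1.le h2
  inner_curves _ := by
    have : ∀ᶠ r : ℝ in 𝓝[≥] (1 : ℝ), r < 2 :=
      mem_nhdsWithin_of_mem_nhds (gt_mem_nhds (by norm_num))
    filter_upwards [this, self_mem_nhdsWithin] with r h1 h2 z hz
    have h2 : 1 ≤ r := h2
    have e : halfBox.map (r * z) = ((1 / 2 * r : ℝ) : ℂ) * z := by
      rw [halfBox_map]; push_cast; ring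
    rw [e]
    exact mul_mem_radial hz (by linarith) (by linarith)
  black_subset := by
    intro p hp
    rw [mem_surface_half]
    exact ⟨hp.2.1, fun h => Colour.not_mem_marked_of_mem_blackArc hp.2.2 h.2.2, hp.1⟩
  locallyConst := by
    intro p hp
    rw [mem_surface_half] at hp
    obtain ⟨h1, h2, h3⟩ := hp
    have hp : p ≠ 0 := by rintro rfl; norm_num at h3
    have h4 : p / (‖p‖ : ℂ) ∉ c.marked := fun h => h2 ⟨h3, h1, h⟩
    filter_upwards [(tendsto_div_norm hp).eventually
      (c.eventually_blackArc (norm_mul_div_norm hp).2 h4)] with q hq hq'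
    rw [mem_surface_half] at hq'
    obtain ⟨h5, h6, h7⟩ := hq'
    have hq0 : q ≠ 0 := by rintro rfl; norm_num at h7
    have := hq (norm_mul_div_norm hq0).2
    exact ⟨fun h => ⟨h3, h1, this.1 h.2.2⟩, fun h => ⟨h7, h5, this.2 h.2.2⟩⟩
  curves_black := subset_closure_radial
    (fun _ => Colour.norm_of_mem_blackArc) c.marked_subset_black
  curves_white := by
    refine (subset_closure_radial
      (fun _ h => h.1) c.marked_subset_white).trans (closure_mono ?_)
    intro p hp
    refine ⟨mem_surface_half.2 ⟨hp.2.1, fun h => hp.2.2.2.1 h.2.2, hp.1⟩, fun h => hp.2.2.2.2 h.2.2⟩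
  outer_black := by
    have : ∀ᶠ r : ℝ in 𝓝[≤] (1 : ℝ), 1 / 2 < r :=
      mem_nhdsWithin_of_mem_nhds (lt_mem_nhds (by norm_num))
    filter_upwards [this, self_mem_nhdsWithin] with r h1 h2 z hz
    exact mul_mem_radial hz h1.le h2
  inner_black _ := by
    have : ∀ᶠ r : ℝ in 𝓝[≥] (1 : ℝ), r < 2 :=
      mem_nhdsWithin_of_mem_nhds (gt_mem_nhds (by norm_num))
    filter_upwards [this, self_mem_nhdsWithin] with r h1 h2 z hz
    have h2 : 1 ≤ r := h2
    have e : halfBox.map (r * z) = ((1 / 2 * r : ℝ) : ℂ) * z := by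
      rw [halfBox_map]; push_cast; ring
    rw [e]
    exact mul_mem_radial hz (by linarith) (by linarith)

namespace Tangle

/-- A homeomorphism of the plane, the identity off the open unit disc, that carries the tangle `T`
to the tangle `T'`: internal boxes with their marked points and `*` to the corresponding ones under
the bijection `σ`, strings to strings and black regions to black regions. As strings are radial near
the boxes, it is no restriction that the map is a similarity on each internal box. -/
structure Carries {ι κ : Type} {c₀ : Colour} {c : ι → Colour} {d : κ → Colour}
    (h : ℂ ≃ₜ ℂ) (σ : ι ≃ κ) (T : Tangle c₀ c) (T' : Tangle c₀ d) : Prop where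
  fix : ∀ z, 1 ≤ ‖z‖ → h z = z
  box : ∀ i z, ‖z‖ ≤ 1 → h ((T.box i).map z) = (T'.box (σ i)).map z
  curves : ∀ p, h p ∈ T'.curves ↔ p ∈ T.curves
  black : ∀ p, h p ∈ T'.black ↔ p ∈ T.black

/-- `T` and `T'` differ by a planar isotopy (an isotopy of the disc, fixed on its boundary) followed
by the renumbering `σ` of the internal boxes. -/
def IsotopicVia {ι κ : Type} {c₀ : Colour} {c : ι → Colour} {d : κ → Colour}
    (σ : ι ≃ κ) (T : Tangle c₀ c) (T' : Tangle c₀ d) : Prop :=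
  ∃ H : unitInterval → (ℂ ≃ₜ ℂ), Continuous (fun x : unitInterval × ℂ => H x.1 x.2) ∧
    H 0 = Homeomorph.refl ℂ ∧ (∀ t z, 1 ≤ ‖z‖ → H t z = z) ∧ Carries (H 1) σ T T'

/-- Planar isotopy of tangles. -/
def Isotopic {ι : Type} {c₀ : Colour} {c : ι → Colour} (T T' : Tangle c₀ c) : Prop :=
  IsotopicVia (Equiv.refl ι) T T'

/-- The homeomorphism `z ↦ t * z` of the plane. -/
def dilate (t : ℝ) (ht : t ≠ 0) : ℂ ≃ₜ ℂ :=
  Homeomorph.mulLeft₀ (t : ℂ) (by exact_mod_cast ht)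

theorem dilate_apply (t : ℝ) (ht : t ≠ 0) (z : ℂ) : dilate t ht z = t * z := rfl

theorem dilate_symm_apply (t : ℝ) (ht : t ≠ 0) (z : ℂ) : (dilate t ht).symm z = (t : ℂ)⁻¹ * z := by
  rw [Homeomorph.symm_apply_eq, dilate_apply]
  have : (t : ℂ) ≠ 0 := by exact_mod_cast ht
  field_simp

open Classical in
/-- The Alexander isotopy from the identity to a homeomorphism. -/
def alexander (h : ℂ ≃ₜ ℂ) (t : ℝ) : ℂ ≃ₜ ℂ :=
  if ht : t = 0 then Homeomorph.refl ℂ else ((dilate t ht).symm.trans h).trans (dilate t ht)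

theorem alexander_zero (h : ℂ ≃ₜ ℂ) : alexander h 0 = Homeomorph.refl ℂ := by
  simp [alexander]

theorem alexander_apply (h : ℂ ≃ₜ ℂ) {t : ℝ} (ht : t ≠ 0) (z : ℂ) :
    alexander h t z = t * h ((t : ℂ)⁻¹ * z) := by
  simp only [alexander, ht, dif_neg, not_false_eq_true, Homeomorph.trans_apply, dilate_apply,
    dilate_symm_apply]

theorem norm_le_of_fix {h : ℂ ≃ₜ ℂ} (hfix : ∀ z, 1 ≤ ‖z‖ → h z = z) {z : ℂ} (hz : ‖z‖ ≤ 1) :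
    ‖h z‖ ≤ 1 := by
  by_contra! hlt
  have := h.injective (hfix _ hlt.le)
  rw [this] at hlt
  linarith

theorem alexander_sub (h : ℂ ≃ₜ ℂ) (hfix : ∀ z, 1 ≤ ‖z‖ → h z = z) (t : ℝ) (ht : 0 ≤ t) (z : ℂ) :
    ‖alexander h t z - z‖ ≤ 2 * t := by
  rcases ht.eq_or_lt with rfl | ht
  · simp [alexander_zero]
  rw [alexander_apply h ht.ne']
  set w := (t : ℂ)⁻¹ * z with hw
  have hz : z = t * w := by
    have : (t : ℂ) ≠ 0 := by exact_mod_cast ht.ne'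
    rw [hw]; field_simp
  have e : (t : ℂ) * h w - z = t * (h w - w) := by rw [mul_sub, ← hz]
  rw [e, norm_mul, Complex.norm_real, Real.norm_of_nonneg ht.le, mul_comm]
  refine mul_le_mul_of_nonneg_right ?_ ht.le
  rcases le_total 1 ‖w‖ with h1 | h1
  · rw [hfix w h1]; simp
  · have := norm_sub_le (h w) w
    have := norm_le_of_fix hfix h1
    linarith

theorem alexander_continuous (h : ℂ ≃ₜ ℂ) (hfix : ∀ z, 1 ≤ ‖z‖ → h z = z) :
    Continuous (fun x : unitInterval × ℂ => alexander h x.1 x.2) := by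
  rw [continuous_iff_continuousAt]
  rintro ⟨t, z⟩
  by_cases ht : t = 0
  · subst ht
    have e : alexander h ((0 : unitInterval) : ℝ) z = z := by simp [alexander_zero]
    unfold ContinuousAt
    simp only [e]
    have h1 : Tendsto (fun x : unitInterval × ℂ => alexander h x.1 x.2 - x.2)
        (𝓝 ((0 : unitInterval), z)) (𝓝 0) := by
      refine squeeze_zero_norm (a := fun x => 2 * (x.1 : ℝ))
        (fun x => alexander_sub h hfix _ x.1.2.1 _) ?_
      have : Continuous (fun x : unitInterval × ℂ => 2 * (x.1 : ℝ)) := by fun_prop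
      simpa using this.tendsto ((0 : unitInterval), z)
    have h2 : Tendsto (fun x : unitInterval × ℂ => x.2) (𝓝 ((0 : unitInterval), z)) (𝓝 z) :=
      continuous_snd.tendsto _
    simpa using h1.add h2
  · have ht' : ((t : ℝ) : ℂ) ≠ 0 := by
      intro h0
      exact ht (Subtype.ext (by exact_mod_cast h0))
    have h1 : ContinuousAt (fun x : unitInterval × ℂ =>
        ((x.1 : ℝ) : ℂ) * h (((x.1 : ℝ) : ℂ)⁻¹ * x.2)) (t, z) := by
      have h2 : ContinuousAt (fun x : unitInterval × ℂ => ((x.1 : ℝ) : ℂ)) (t, z) := by fun_prop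
      have h3 : ContinuousAt (fun x : unitInterval × ℂ => ((x.1 : ℝ) : ℂ)⁻¹ * x.2) (t, z) :=
        (h2.inv₀ ht').mul (by fun_prop)
      exact h2.mul (ContinuousAt.comp (g := h) h.continuous.continuousAt h3)
    refine h1.congr ?_
    have : ∀ᶠ x : unitInterval × ℂ in 𝓝 (t, z), x.1 ≠ 0 :=
      continuous_fst.continuousAt.eventually_ne ht
    filter_upwards [this] with x hx
    rw [alexander_apply]
    · intro h0
      exact hx (Subtype.ext h0)

theorem isotopicVia_iff {ι κ : Type} {c₀ : Colour} {c : ι → Colour} {d : κ → Colour}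
    {σ : ι ≃ κ} {T : Tangle c₀ c} {T' : Tangle c₀ d} :
    IsotopicVia σ T T' ↔ ∃ h, Carries h σ T T' := by
  constructor
  · rintro ⟨H, _, _, _, h⟩
    exact ⟨_, h⟩
  · rintro ⟨h, hh⟩
    refine ⟨fun t => alexander h t, alexander_continuous h hh.fix, alexander_zero h, ?_, ?_⟩
    · rintro t z hz
      by_cases ht : (t : ℝ) = 0
      · simp only [ht, alexander_zero]; rfl
      · have ht0 : 0 < (t : ℝ) := lt_of_le_of_ne t.2.1 (Ne.symm ht)
        have ht' : ((t : ℝ) : ℂ) ≠ 0 := by exact_mod_cast ht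
        simp only [alexander_apply h ht]
        rw [hh.fix]
        · field_simp
        · rw [norm_mul, norm_inv, Complex.norm_real, Real.norm_of_nonneg ht0.le]
          have := one_le_inv_iff₀.2 ⟨ht0, t.2.2⟩
          nlinarith
    · have : alexander h ((1 : unitInterval) : ℝ) = h := by
        ext z
        rw [alexander_apply h (by simp)]
        simp
      simp only [this]
      exact hh

section

variable {ι κ μ : Type} {c₀ : Colour} {c : ι → Colour} {d : κ → Colour} {e : μ → Colour}
  {T : Tangle c₀ c} {T' : Tangle c₀ d} {T'' : Tangle c₀ e}

theorem Carries.refl (T : Tangle c₀ c) : Carries (Homeomorph.refl ℂ) (Equiv.refl ι) T T :=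
  ⟨fun _ _ => rfl, fun _ _ _ => rfl, fun _ => Iff.rfl, fun _ => Iff.rfl⟩

theorem Carries.symm {h : ℂ ≃ₜ ℂ} {σ : ι ≃ κ} (hh : Carries h σ T T') :
    Carries h.symm σ.symm T' T where
  fix z hz := by rw [Homeomorph.symm_apply_eq, hh.fix z hz]
  box i z hz := by rw [Homeomorph.symm_apply_eq, hh.box _ z hz, Equiv.apply_symm_apply]
  curves p := by rw [← hh.curves, Homeomorph.apply_symm_apply]
  black p := by rw [← hh.black, Homeomorph.apply_symm_apply]

theorem Carries.trans {h h' : ℂ ≃ₜ ℂ} {σ : ι ≃ κ} {τ : κ ≃ μ} (hh : Carries h σ T T')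
    (hh' : Carries h' τ T' T'') : Carries (h.trans h') (σ.trans τ) T T'' where
  fix z hz := by rw [Homeomorph.trans_apply, hh.fix z hz, hh'.fix z hz]
  box i z hz := by rw [Homeomorph.trans_apply, hh.box i z hz, hh'.box _ z hz]; rfl
  curves p := by rw [Homeomorph.trans_apply, hh'.curves, hh.curves]
  black p := by rw [Homeomorph.trans_apply, hh'.black, hh.black]

theorem IsotopicVia.refl (T : Tangle c₀ c) : IsotopicVia (Equiv.refl ι) T T :=
  isotopicVia_iff.2 ⟨_, Carries.refl T⟩

theorem IsotopicVia.symm {σ : ι ≃ κ} (h : IsotopicVia σ T T') : IsotopicVia σ.symm T' T := by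
  obtain ⟨h, hh⟩ := isotopicVia_iff.1 h
  exact isotopicVia_iff.2 ⟨_, hh.symm⟩

theorem IsotopicVia.trans {σ : ι ≃ κ} {τ : κ ≃ μ} (h : IsotopicVia σ T T')
    (h' : IsotopicVia τ T' T'') : IsotopicVia (σ.trans τ) T T'' := by
  obtain ⟨h, hh⟩ := isotopicVia_iff.1 h
  obtain ⟨h', hh'⟩ := isotopicVia_iff.1 h'
  exact isotopicVia_iff.2 ⟨_, hh.trans hh'⟩

theorem isotopicVia_reindex (T : Tangle c₀ c) (σ : κ ≃ ι) : IsotopicVia σ (T.reindex σ) T :=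
  isotopicVia_iff.2 ⟨Homeomorph.refl ℂ, fun _ _ => rfl, fun _ _ _ => rfl, fun _ => Iff.rfl,
    fun _ => Iff.rfl⟩

end

section

variable {ι : Type} [Finite ι] {κ κ' : ι → Type} {c₀ : Colour} {c : ι → Colour}
  {d : ∀ i, κ i → Colour} {d' : ∀ i, κ' i → Colour}

/-- Homeomorphisms of the boxes of a disjoint family, fixed on their boundaries, glue. -/
theorem exists_glue {ι : Type} [Finite ι] (box : ι → Box)
    (hd : ∀ i j, i ≠ j → ∀ z w, ‖z‖ ≤ 1 → ‖w‖ ≤ 1 → (box i).map z ≠ (box j).map w)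
    (g : ι → (ℂ ≃ₜ ℂ))
    (hg : ∀ i z, 1 ≤ ‖z‖ → g i z = z) :
    ∃ G : ℂ ≃ₜ ℂ, (∀ i z, ‖z‖ ≤ 1 → G ((box i).map z) = (box i).map (g i z)) ∧
      ∀ p, (∀ i z, ‖z‖ < 1 → (box i).map z ≠ p) → G p = p := by
  classical
  cases nonempty_fintype ι
  suffices h : ∀ s : Finset ι, ∃ G : ℂ ≃ₜ ℂ,
      (∀ i ∈ s, ∀ z, ‖z‖ ≤ 1 → G ((box i).map z) = (box i).map (g i z)) ∧
      ∀ p, (∀ i ∈ s, ∀ z, ‖z‖ < 1 → (box i).map z ≠ p) → G p = p by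
    obtain ⟨G, h1, h2⟩ := h Finset.univ
    exact ⟨G, fun i => h1 i (Finset.mem_univ i), fun p hp => h2 p fun i _ => hp i⟩
  intro s
  induction s using Finset.induction_on with
  | empty => exact ⟨Homeomorph.refl ℂ, by simp, fun _ _ => rfl⟩
  | insert a s ha ih =>
    obtain ⟨G, h1, h2⟩ := ih
    let B := (box a).homeo
    let F : ℂ ≃ₜ ℂ := (B.symm.trans (g a)).trans B
    have hF : ∀ z, F ((box a).map z) = (box a).map (g a z) := fun z => by
      simp only [F, Homeomorph.trans_apply]
      rw [← Box.homeo_apply, Homeomorph.symm_apply_apply]; rfl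
    have hF' : ∀ p, (∀ z, ‖z‖ < 1 → (box a).map z ≠ p) → F p = p := fun p hp => by
      obtain ⟨z, rfl⟩ := (box a).exists_map p
      rw [hF, hg a z]
      by_contra! hz
      exact hp z hz rfl
    refine ⟨F.trans G, ?_, ?_⟩
    · intro i hi z hz
      rw [Homeomorph.trans_apply]
      rcases Finset.mem_insert.1 hi with rfl | hi
      · rw [hF, h2]
        intro j hj w hw h
        have hij : j ≠ i := by rintro rfl; exact ha hj
        exact hd j i hij _ _ hw.le (norm_le_of_fix (hg i) hz) h
      · have hia : a ≠ i := by rintro rfl; exact ha hi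
        rw [hF', h1 i hi z hz]
        exact fun w hw => hd a i hia _ _ hw.le hz
    · intro p hp
      rw [Homeomorph.trans_apply, hF' p (hp a (Finset.mem_insert_self a s)), h2]
      exact fun i hi => hp i (Finset.mem_insert_of_mem hi)

/-- Isotopic outer tangles give isotopic substitutions. -/
theorem IsotopicVia.comp_left {T T' : Tangle c₀ c} (h : Isotopic T T')
    (S : ∀ i, Tangle (c i) (d i)) : Isotopic (T.comp S) (T'.comp S) := by
  obtain ⟨h, hh⟩ := isotopicVia_iff.1 h
  refine isotopicVia_iff.2 ⟨h, hh.fix, ?_, ?_, ?_⟩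
  · rintro ⟨i, j⟩ z hz
    simp only [comp, Box.comp_map]
    exact hh.box i _ ((S i).norm_box_lt j hz).le
  · intro p
    simp only [comp, mem_glue, hh.curves]
    refine or_congr_right (exists_congr fun i => exists_congr fun z => and_congr_right fun hz => ?_)
    have := hh.box i z ((S i).curves_inside z hz)
    rw [Equiv.refl_apply] at this
    rw [← this, h.injective.eq_iff]
  · intro p
    simp only [comp, mem_glue, hh.black]
    refine or_congr_right (exists_congr fun i => exists_congr fun z => and_congr_right fun hz => ?_)
    have := hh.box i z ((S i).black_subset hz).1
    rw [Equiv.refl_apply] at this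
    rw [← this, h.injective.eq_iff]

/-- Isotopic inner tangles give isotopic substitutions. -/
theorem IsotopicVia.comp_right (T : Tangle c₀ c) {S : ∀ i, Tangle (c i) (d i)}
    {S' : ∀ i, Tangle (c i) (d' i)} (σ : ∀ i, κ i ≃ κ' i)
    (h : ∀ i, IsotopicVia (σ i) (S i) (S' i)) :
    IsotopicVia (Equiv.sigmaCongrRight σ) (T.comp S) (T.comp S') := by
  choose g hg using fun i => isotopicVia_iff.1 (h i)
  obtain ⟨G, h1, h2⟩ := exists_glue T.box T.box_disjoint g (fun i => (hg i).fix)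
  have key : ∀ p, (∀ i z, ‖z‖ < 1 → (T.box i).map z ≠ p) ∨ ∃ i z, ‖z‖ ≤ 1 ∧ (T.box i).map z = p := by
    intro p
    by_contra! h
    obtain ⟨⟨i, z, hz, hz'⟩, h⟩ := h
    exact h i z hz.le hz'
  refine isotopicVia_iff.2 ⟨G, ?_, ?_, ?_, ?_⟩
  · intro p hp
    refine h2 p ?_
    rintro i z hz rfl
    have := T.norm_box_lt i hz.le
    linarith
  · rintro ⟨i, j⟩ z hz
    simp only [comp, Box.comp_map, Equiv.sigmaCongrRight_apply]
    rw [h1 i _ ((S i).norm_box_lt j hz).le, (hg i).box j z hz]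
  · intro p
    rcases key p with hp | ⟨i, z, hz, rfl⟩
    · rw [h2 p hp]
      simp only [comp]
      rw [T.glue_curves_out S hp, T.glue_curves_out S' hp]
    · rw [h1 i z hz]
      simp only [comp]
      rw [T.glue_curves_in S hz, T.glue_curves_in S' (norm_le_of_fix (hg i).fix hz), (hg i).curves]
  · intro p
    rcases key p with hp | ⟨i, z, hz, rfl⟩
    · rw [h2 p hp]
      simp only [comp]
      rw [T.glue_black_out S hp, T.glue_black_out S' hp]
    · rw [h1 i z hz]
      simp only [comp]
      rw [T.glue_black_in S hz, T.glue_black_in S' (norm_le_of_fix (hg i).fix hz), (hg i).black]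

theorem glue_assoc {ι : Type} {κ : ι → Type} {B : ι → Box} {B' : ∀ i, κ i → Box} {X : Set ℂ}
    {Y : ι → Set ℂ} {Z : ∀ i, κ i → Set ℂ} :
    glue (fun x : Σ i, κ i => (B x.1).comp (B' x.1 x.2)) (glue B X Y) (fun x => Z x.1 x.2) =
      glue B X (fun i => glue (B' i) (Y i) (Z i)) := by
  ext p
  simp only [mem_glue, Sigma.exists, Box.comp_map]
  constructor
  · rintro ((h | ⟨i, z, hz, rfl⟩) | ⟨i, j, z, hz, rfl⟩)
    · exact Or.inl h
    · exact Or.inr ⟨i, z, Or.inl hz, rfl⟩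
    · exact Or.inr ⟨i, _, Or.inr ⟨j, z, hz, rfl⟩, rfl⟩
  · rintro (h | ⟨i, _, hz | ⟨j, z, hz, rfl⟩, rfl⟩)
    · exact Or.inl (Or.inl h)
    · exact Or.inl (Or.inr ⟨i, _, hz, rfl⟩)
    · exact Or.inr ⟨i, j, z, hz, rfl⟩

/-- Substitution is associative. -/
theorem comp_assoc [∀ i, Finite (κ i)] {μ : ∀ i, κ i → Type} {e : ∀ i j, μ i j → Colour}
    (T : Tangle c₀ c) (S : ∀ i, Tangle (c i) (d i)) (R : ∀ i j, Tangle (d i j) (e i j)) :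
    IsotopicVia (Equiv.sigmaAssoc μ) ((T.comp S).comp (fun x : Σ i, κ i => R x.1 x.2))
      (T.comp (fun i => (S i).comp (R i))) := by
  refine isotopicVia_iff.2 ⟨Homeomorph.refl ℂ, fun _ _ => rfl, ?_, ?_, ?_⟩
  · rintro ⟨⟨i, j⟩, k⟩ z hz
    simp [comp, Box.comp_map, Equiv.sigmaAssoc]
  · intro p
    simp only [comp, Homeomorph.refl_apply, id]
    rw [glue_assoc (B' := fun i => (S i).box) (Z := fun i j => (R i j).curves)]
  · intro p
    simp only [comp, Homeomorph.refl_apply, id]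
    rw [glue_assoc (B' := fun i => (S i).box) (Z := fun i j => (R i j).black)]

/-- Renumbering before substitution. -/
theorem reindex_comp {ι' : Type} [Finite ι'] (T : Tangle c₀ c) (f : ι' ≃ ι)
    (S : ∀ i, Tangle (c i) (d i)) :
    IsotopicVia (Equiv.sigmaCongrLeft (β := κ) f)
      ((T.reindex f).comp (fun j => S (f j))) (T.comp S) := by
  refine isotopicVia_iff.2 ⟨Homeomorph.refl ℂ, fun _ _ => rfl, ?_, ?_, ?_⟩
  · rintro ⟨i, j⟩ z hz
    simp [comp, reindex, Box.comp_map]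
  · intro p
    simp only [comp, reindex, Homeomorph.refl_apply, id, mem_glue]
    rw [f.exists_congr_right (q := fun i => ∃ z ∈ (S i).curves, (T.box i).map z = p)]
  · intro p
    simp only [comp, reindex, Homeomorph.refl_apply, id, mem_glue]
    rw [f.exists_congr_right (q := fun i => ∃ z ∈ (S i).black, (T.box i).map z = p)]

end
theorem radial_continuous (f : ℝ ≃o ℝ) (hf : f 0 = 0) :
    Continuous fun p : ℂ => (f ‖p‖ : ℂ) * (p / ‖p‖) := by
  have hc : Continuous fun p : ℂ => f ‖p‖ := f.continuous.comp continuous_norm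
  rw [continuous_iff_continuousAt]
  intro p
  by_cases hp : p = 0
  · subst hp
    unfold ContinuousAt
    simp only [norm_zero, hf, Complex.ofReal_zero, zero_mul]
    refine squeeze_zero_norm (a := fun p : ℂ => f ‖p‖) ?_ (by simpa [hf] using hc.tendsto 0)
    intro p
    have h1 : 0 ≤ f ‖p‖ := by rw [← hf]; exact f.monotone (norm_nonneg p)
    rw [norm_mul, Complex.norm_real, Real.norm_of_nonneg h1]
    by_cases hp : p = 0
    · simp [hp, hf]
    · rw [(norm_mul_div_norm hp).2, mul_one]
  · have h1 : ContinuousAt (fun x : ℂ => x / (‖x‖ : ℂ)) p := tendsto_div_norm hp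
    exact (Complex.continuous_ofReal.comp hc).continuousAt.mul h1

theorem radial_aux (f : ℝ ≃o ℝ) (hf : f 0 = 0) (p : ℂ) :
    (f.symm ‖(f ‖p‖ : ℂ) * (p / ‖p‖)‖ : ℂ) *
      ((f ‖p‖ : ℂ) * (p / ‖p‖) / ‖(f ‖p‖ : ℂ) * (p / ‖p‖)‖) = p := by
  by_cases hp : p = 0
  · simp [hp, hf]
  obtain ⟨e1, e2⟩ := norm_mul_div_norm hp
  have hpos : 0 < f ‖p‖ := by rw [← hf]; exact f.strictMono (norm_pos_iff.2 hp)
  have hn : ‖(f ‖p‖ : ℂ) * (p / ‖p‖)‖ = f ‖p‖ := by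
    rw [norm_mul, e2, mul_one, Complex.norm_real, Real.norm_of_nonneg hpos.le]
  rw [hn, OrderIso.symm_apply_apply]
  have : (f ‖p‖ : ℂ) ≠ 0 := by exact_mod_cast hpos.ne'
  rw [mul_div_cancel_left₀ _ this, e1]

/-- A homeomorphism of the plane that stretches each radius in the same way. -/
def radialHomeo (f : ℝ ≃o ℝ) (hf : f 0 = 0) : ℂ ≃ₜ ℂ where
  toFun p := (f ‖p‖ : ℂ) * (p / ‖p‖)
  invFun p := (f.symm ‖p‖ : ℂ) * (p / ‖p‖)
  left_inv p := radial_aux f hf p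
  right_inv p := by
    have hf' : f.symm 0 = 0 := by rw [OrderIso.symm_apply_eq, hf]
    exact radial_aux f.symm hf' p
  continuous_toFun := radial_continuous f hf
  continuous_invFun := radial_continuous f.symm (by rw [OrderIso.symm_apply_eq, hf])

theorem radialHomeo_apply (f : ℝ ≃o ℝ) (hf : f 0 = 0) (p : ℂ) :
    radialHomeo f hf p = (f ‖p‖ : ℂ) * (p / ‖p‖) := rfl

theorem exists_stretch {r₀ : ℝ} (h0 : 0 < r₀) (h1 : r₀ < 1) :
    ∃ f : ℝ ≃o ℝ, (∀ r, r ≤ r₀ / 2 → f r = 2 * r) ∧ ∀ r, 1 ≤ r → f r = r := by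
  set α := (1 - r₀) / (1 - r₀ / 2) with hα
  have hd : 0 < 1 - r₀ / 2 := by linarith
  have hα0 : 0 < α := div_pos (by linarith) hd
  have hα1 : α < 1 := by rw [hα, div_lt_one hd]; linarith
  have hαe : α * (1 - r₀ / 2) = 1 - r₀ := div_mul_cancel₀ _ hd.ne'
  let F : ℝ → ℝ := fun r => min (2 * r) (max (α * r + (1 - α)) r)
  have hm : StrictMono F := by
    intro x y h
    have h2 : α * x + (1 - α) < α * y + (1 - α) := by nlinarith
    exact min_lt_min (by linarith) (max_lt_max h2 h)
  have hc : Continuous F := by fun_prop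
  have hlow : ∀ r, r ≤ r₀ / 2 → F r = 2 * r := by
    intro r hr
    refine min_eq_left (le_max_of_le_left ?_)
    nlinarith
  have hhigh : ∀ r, 1 ≤ r → F r = r := by
    intro r hr
    have : max (α * r + (1 - α)) r = r := max_eq_right (by nlinarith)
    simp only [F]
    rw [this, min_eq_right (by linarith)]
  have ht : Tendsto F atTop atTop := by
    refine tendsto_id.congr' ?_
    filter_upwards [eventually_ge_atTop 1] with r hr using (hhigh r hr).symm
  have hb : Tendsto F atBot atBot := by
    have : Tendsto (fun r : ℝ => 2 * r) atBot atBot := tendsto_id.const_mul_atBot (by norm_num)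
    refine this.congr' ?_
    filter_upwards [eventually_le_atBot (r₀ / 2)] with r hr using (hlow r hr).symm
  exact ⟨hm.orderIsoOfSurjective F (hc.surjective ht hb), hlow, hhigh⟩

theorem stretch_iff {r₀ : ℝ} {f : ℝ ≃o ℝ} {hf : f 0 = 0}
    (hlow : ∀ r, r ≤ r₀ / 2 → f r = 2 * r) (hhigh : ∀ r, 1 ≤ r → f r = r)
    {X Y A : Set ℂ} (hX : ∀ r : ℝ, r₀ ≤ r → r ≤ 1 → ∀ z : ℂ, ‖z‖ = 1 → (r * z ∈ X ↔ z ∈ A))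
    (hX1 : ∀ p ∈ X, ‖p‖ ≤ 1) (hY1 : ∀ p ∈ Y, ‖p‖ ≤ 1) (h1 : r₀ < 1)
    (hin : ∀ q, ‖q‖ ≤ 1 → (halfBox.map q ∈ Y ↔ q ∈ X))
    (hout : ∀ p, 1 / 2 ≤ ‖p‖ → (p ∈ Y ↔ p ∈ radial A)) (p : ℂ) :
    radialHomeo f hf p ∈ X ↔ p ∈ Y := by
  by_cases hp : p = 0
  · subst hp
    have e : radialHomeo f hf 0 = 0 := by simp [radialHomeo_apply]
    have := hin 0 (by simp)
    rw [halfBox_map, mul_zero] at this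
    rw [e, this]
  obtain ⟨e1, e2⟩ := norm_mul_div_norm hp
  have e : radialHomeo f hf p = (f ‖p‖ : ℂ) * (p / ‖p‖) := rfl
  rcases lt_or_ge 1 ‖p‖ with h | h
  · have : radialHomeo f hf p = p := by rw [e, hhigh _ h.le, e1]
    rw [this]
    exact ⟨fun h' => (h.not_ge (hX1 _ h')).elim, fun h' => (h.not_ge (hY1 _ h')).elim⟩
  rcases le_total ‖p‖ (r₀ / 2) with h2 | h2
  · have e3 : radialHomeo f hf p = 2 * p := by
      rw [e, hlow _ h2, Complex.ofReal_mul, mul_assoc, e1]; simp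
    have : ‖2 * p‖ ≤ 1 := by rw [norm_mul]; norm_num; linarith
    rw [e3, ← hin _ this, halfBox_map]
    congr! 1
    ring
  have e3 : radialHomeo f hf p ∈ X ↔ p / (‖p‖ : ℂ) ∈ A := by
    rw [e]
    refine hX _ ?_ ?_ _ e2
    · have := f.monotone h2
      rw [hlow _ le_rfl] at this
      linarith
    · have := f.monotone h
      rwa [hhigh _ le_rfl] at this
  rw [e3]
  rcases le_total ‖p‖ (1 / 2) with h3 | h3
  · have h4 : ‖2 * p‖ ≤ 1 := by rw [norm_mul]; norm_num; linarith
    have h5 := hin _ h4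
    have e4 : halfBox.map (2 * p) = p := by rw [halfBox_map]; ring
    rw [e4] at h5
    rw [h5, ← hX (2 * ‖p‖) (by linarith) (by linarith) _ e2, Complex.ofReal_mul, mul_assoc, e1]
    simp
  · rw [hout p h3]
    exact ⟨fun h' => ⟨h3, h, h'⟩, fun h' => h'.2.2⟩

/-- Substitution into the identity tangle. -/
theorem id_comp {κ : Type} [Finite κ] {c : Colour} {d : κ → Colour} (S : Tangle c d) :
    IsotopicVia (Equiv.uniqueSigma (fun _ : Unit => κ))
      ((idTangle c).comp (fun _ : Unit => S)) S := by
  have hev : ∀ᶠ r : ℝ in 𝓝[≤] (1 : ℝ), (∀ z : ℂ, ‖z‖ = 1 → (r * z ∈ S.curves ↔ z ∈ c.marked)) ∧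
      (∀ z : ℂ, ‖z‖ = 1 → (r * z ∈ S.black ↔ z ∈ c.blackArc)) ∧
      (∀ j, ‖(S.box j).center‖ + ‖(S.box j).scale‖ < r) ∧ 0 < r :=
    S.outer_curves.and (S.outer_black.and ((Filter.eventually_all.2 fun j =>
      mem_nhdsWithin_of_mem_nhds (lt_mem_nhds (S.box_inside j))).and
      (mem_nhdsWithin_of_mem_nhds (lt_mem_nhds one_pos))))
  obtain ⟨l, hl, hl'⟩ := mem_nhdsLE_iff_exists_Ioc_subset.1 hev
  have hl : l < 1 := hl
  set r₀ := (l + 1) / 2 with hr₀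
  have hr : ∀ r, r₀ ≤ r → r ≤ 1 → r ∈ Ioc l 1 := fun r h1 h2 => ⟨by linarith, h2⟩
  have h1 : r₀ < 1 := by linarith
  obtain ⟨-, -, hbox, h0⟩ := hl' (hr r₀ le_rfl h1.le)
  obtain ⟨f, hlow, hhigh⟩ := exists_stretch h0 h1
  have hf : f 0 = 0 := by rw [hlow 0 (by linarith)]; simp
  have hout : ∀ p : ℂ, 1 / 2 ≤ ‖p‖ → ∀ (i : Unit) z, ‖z‖ < 1 → ((idTangle c).box i).map z ≠ p := by
    rintro p hp _ z hz rfl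
    have := norm_halfBox_map z
    simp only [idTangle] at hp
    linarith
  refine isotopicVia_iff.2 ⟨radialHomeo f hf, ?_, ?_, ?_, ?_⟩
  · intro z hz
    have hz0 : z ≠ 0 := by rintro rfl; norm_num at hz
    have e : radialHomeo f hf z = (f ‖z‖ : ℂ) * (z / ‖z‖) := rfl
    rw [e, hhigh _ hz, (norm_mul_div_norm hz0).1]
  · rintro ⟨⟨⟩, j⟩ z hz
    simp only [comp, Box.comp_map, idTangle]
    change _ = (S.box j).map z
    set w := (S.box j).map z with hw
    have h2 : ‖w‖ ≤ r₀ := by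
      have h3 := (S.box j).norm_map_le z
      have h4 := hbox j
      have h5 := norm_nonneg (S.box j).scale
      nlinarith
    by_cases hw0 : w = 0
    · rw [hw0, halfBox_map]; simp [radialHomeo_apply]
    have hw1 : halfBox.map w ≠ 0 := by rw [halfBox_map]; simpa using hw0
    have e : radialHomeo f hf (halfBox.map w) =
      (f ‖halfBox.map w‖ : ℂ) * (halfBox.map w / ‖halfBox.map w‖) := rfl
    rw [e, hlow _ (by rw [norm_halfBox_map]; linarith), Complex.ofReal_mul, mul_assoc,
      (norm_mul_div_norm hw1).1, halfBox_map]
    push_cast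
    ring
  · refine stretch_iff hlow hhigh (A := c.marked) (fun r a b => (hl' (hr r a b)).1)
      S.curves_inside (Tangle.curves_inside _) h1 ?_ ?_
    · intro q hq
      exact (idTangle c).glue_curves_in (fun _ => S) (i := ()) hq
    · intro p hp
      exact (idTangle c).glue_curves_out (fun _ => S) (hout p hp)
  · refine stretch_iff hlow hhigh (A := c.blackArc) (fun r a b => (hl' (hr r a b)).2.1)
      (fun p hp => (S.black_subset hp).1) (fun p hp => (Tangle.black_subset _ hp).1) h1 ?_ ?_
    · intro q hq
      exact (idTangle c).glue_black_in (fun _ => S) (i := ()) hq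
    · intro p hp
      exact (idTangle c).glue_black_out (fun _ => S) (hout p hp)

end Tangle

universe u v w

/-- A planar algebra over a field `K`: a vector space for each colour and, for each planar tangle, a
multilinear map from the spaces of the colours of its internal boxes to that of its external box,
compatible with planar isotopy, renumbering of the internal boxes and substitution, with
the identity tangles acting as identity maps. Internal boxes are indexed by arbitrary finite types,
so that a numbering is not needed to substitute. -/
structure PlanarAlgebra (K : Type v) [Field K] where
  space : Colour → Type u
  [addCommGroup : ∀ c, AddCommGroup (space c)]
  [module : ∀ c, Module K (space c)]
  Z : ∀ {ι : Type} [Finite ι] {c₀ : Colour} {c : ι → Colour}, Tangle c₀ c →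
    MultilinearMap K (fun i => space (c i)) (space c₀)
  isotopy : ∀ {ι : Type} [Finite ι] {c₀ : Colour} {c : ι → Colour} (T T' : Tangle c₀ c),
    T.Isotopic T' → Z T = Z T'
  renumber : ∀ {ι κ : Type} [Finite ι] [Finite κ] {c₀ : Colour} {c : ι → Colour}
    (T : Tangle c₀ c) (e : κ ≃ ι) (x : ∀ i, space (c i)),
    Z (T.reindex e) (fun j => x (e j)) = Z T x
  substitute : ∀ {ι : Type} [Finite ι] {κ : ι → Type} [∀ i, Finite (κ i)] {c₀ : Colour}
    {c : ι → Colour} {d : ∀ i, κ i → Colour} (T : Tangle c₀ c) (S : ∀ i, Tangle (c i) (d i))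
    (x : ∀ i j, space (d i j)),
    Z (T.comp S) (fun y => x y.1 y.2) = Z T (fun i => Z (S i) (x i))
  identity : ∀ (c : Colour) (x : space c), Z (idTangle c) (fun _ => x) = x

attribute [instance] PlanarAlgebra.addCommGroup PlanarAlgebra.module

namespace PlanarAlgebra

variable {K : Type v} [Field K]

/-- A morphism of planar algebras: linear maps that commute with the action of all tangles. -/
structure Hom (P : PlanarAlgebra.{u} K) (Q : PlanarAlgebra.{w} K) where
  toFun : ∀ c, P.space c →ₗ[K] Q.space c
  map_Z : ∀ {ι : Type} [Finite ι] {c₀ : Colour} {c : ι → Colour} (T : Tangle c₀ c)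
    (x : ∀ i, P.space (c i)), toFun c₀ (P.Z T x) = Q.Z T (fun i => toFun (c i) (x i))

/-- A morphism of planar algebras is surjective if it is so in every colour. -/
def Hom.Surjective {P : PlanarAlgebra.{u} K} {Q : PlanarAlgebra.{w} K} (f : Hom P Q) : Prop :=
  ∀ c, Function.Surjective (f.toFun c)

/-- A planar ideal: a subspace in each colour such that the result of the action of a tangle lies in
it as soon as one of the inputs does. -/
@[ext]
structure PlanarIdeal (P : PlanarAlgebra.{u} K) where
  carrier : ∀ c, Submodule K (P.space c)
  absorb : ∀ {ι : Type} [Finite ι] {c₀ : Colour} {c : ι → Colour} (T : Tangle c₀ c)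
    (x : ∀ i, P.space (c i)) (i : ι), x i ∈ carrier (c i) → P.Z T x ∈ carrier c₀

/-- The planar ideal generated by a set of elements of a planar algebra, i.e. the intersection of
the planar ideals that contain it. -/
def PlanarIdeal.span (P : PlanarAlgebra.{u} K) (R : Set (Σ c, P.space c)) : PlanarIdeal P where
  carrier c := sInf {M | ∃ J : PlanarIdeal P, (∀ r ∈ R, r.2 ∈ J.carrier r.1) ∧ M = J.carrier c}
  absorb := by
    rintro ι _ c₀ c T x i hi
    rw [Submodule.mem_sInf] at hi ⊢
    rintro _ ⟨J, hJ, rfl⟩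
    exact J.absorb T x i (hi _ ⟨J, hJ, rfl⟩)

/-- A planar ideal is finitely generated if it is generated by a finite set of elements. -/
def PlanarIdeal.FG {P : PlanarAlgebra.{u} K} (I : PlanarIdeal P) : Prop :=
  ∃ R : Set (Σ c, P.space c), R.Finite ∧ PlanarIdeal.span P R = I

/-- The kernel of a morphism of planar algebras. -/
def Hom.ker {P : PlanarAlgebra.{u} K} {Q : PlanarAlgebra.{w} K} (f : Hom P Q) :
    PlanarIdeal P where
  carrier c := LinearMap.ker (f.toFun c)
  absorb := by
    rintro ι _ c₀ c T x i hi
    rw [LinearMap.mem_ker] at hi ⊢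
    rw [f.map_Z]
    exact MultilinearMap.map_coord_zero _ i hi

end PlanarAlgebra

section universal

variable {L : Type w} (col : L → Colour)

/-- A tangle whose internal boxes are labelled by elements of a label set `L`, where a label `l` may
be put on boxes of colour `col l` only. -/
structure LabelledTangle (c₀ : Colour) where
  boxes : ℕ
  label : Fin boxes → L
  tangle : Tangle c₀ (fun i => col (label i))

/-- Labelled tangles are regarded up to planar isotopy that preserves the labels. -/
instance LabelledTangle.setoid (c₀ : Colour) : Setoid (LabelledTangle col c₀) where
  r x y := ∃ σ : Fin x.boxes ≃ Fin y.boxes, (∀ i, y.label (σ i) = x.label i) ∧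
    Tangle.IsotopicVia σ x.tangle y.tangle
  iseqv :=
    { refl := fun x => ⟨Equiv.refl _, fun _ => rfl, Tangle.IsotopicVia.refl _⟩
      symm := fun ⟨σ, h1, h2⟩ => ⟨σ.symm, fun i => by rw [← h1, Equiv.apply_symm_apply], h2.symm⟩
      trans := fun ⟨σ, h1, h2⟩ ⟨τ, h3, h4⟩ =>
        ⟨σ.trans τ, fun i => by rw [Equiv.trans_apply, h3, h1], h2.trans h4⟩ }

/-- The set of `L`-labelled tangles with external box of colour `c₀`, up to planar isotopy. -/
def LabelledClass (c₀ : Colour) : Type w := Quotient (LabelledTangle.setoid col c₀)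

namespace LabelledClass

variable {col}

/-- The class of a labelled tangle, with boxes indexed by any finite type. -/
def mk {κ : Type} [Finite κ] {c₀ : Colour} (lab : κ → L)
    (T : Tangle c₀ (fun i => col (lab i))) : LabelledClass col c₀ :=
  Quotient.mk (LabelledTangle.setoid col c₀)
    ⟨Nat.card κ, fun i => lab ((Finite.equivFin κ).symm i), T.reindex (Finite.equivFin κ).symm⟩

theorem mk_eq {κ κ' : Type} [Finite κ] [Finite κ'] {c₀ : Colour} {lab : κ → L} {lab' : κ' → L}
    {T : Tangle c₀ (fun i => col (lab i))} {T' : Tangle c₀ (fun i => col (lab' i))}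
    (σ : κ ≃ κ') (h1 : ∀ i, lab' (σ i) = lab i) (h2 : Tangle.IsotopicVia σ T T') :
    mk lab T = mk lab' T' := by
  refine Quotient.sound ⟨(Finite.equivFin κ).symm.trans (σ.trans (Finite.equivFin κ')), ?_, ?_⟩
  · intro i
    simp [h1]
  · exact (Tangle.isotopicVia_reindex T _).trans
      (h2.trans (Tangle.isotopicVia_reindex T' (Finite.equivFin κ').symm).symm)

theorem exists_of_mk_eq {κ κ' : Type} [Finite κ] [Finite κ'] {c₀ : Colour} {lab : κ → L}
    {lab' : κ' → L} {T : Tangle c₀ (fun i => col (lab i))} {T' : Tangle c₀ (fun i => col (lab' i))}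
    (h : mk lab T = mk lab' T') :
    ∃ σ : κ ≃ κ', (∀ i, lab' (σ i) = lab i) ∧ Tangle.IsotopicVia σ T T' := by
  obtain ⟨σ, h1, h2⟩ := Quotient.exact h
  refine ⟨(Finite.equivFin κ).trans (σ.trans (Finite.equivFin κ').symm), ?_, ?_⟩
  · intro i
    have := h1 (Finite.equivFin κ i)
    simpa using this
  · exact ((Tangle.isotopicVia_reindex T (Finite.equivFin κ).symm).symm.trans h2).trans
      (Tangle.isotopicVia_reindex T' (Finite.equivFin κ').symm)

theorem mk_out {c₀ : Colour} (q : LabelledClass col c₀) :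
    mk (Quotient.out q).label (Quotient.out q).tangle = q := by
  conv_rhs => rw [← Quotient.out_eq q]
  exact Quotient.sound ⟨(Finite.equivFin _).symm, fun _ => rfl, Tangle.isotopicVia_reindex _ _⟩

/-- Substitution of labelled tangles into the boxes of a tangle. -/
def act {ι : Type} [Finite ι] {c₀ : Colour} {c : ι → Colour} (T : Tangle c₀ c)
    (q : ∀ i, LabelledClass col (c i)) : LabelledClass col c₀ :=
  mk (fun x : Σ i, Fin (Quotient.out (q i)).boxes => (Quotient.out (q x.1)).label x.2)
    (T.comp (fun i => (Quotient.out (q i)).tangle))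

theorem act_mk {ι : Type} [Finite ι] {κ : ι → Type} [∀ i, Finite (κ i)] {c₀ : Colour}
    {c : ι → Colour} (T : Tangle c₀ c) (lab : ∀ i, κ i → L)
    (S : ∀ i, Tangle (c i) (fun j => col (lab i j))) :
    act T (fun i => mk (lab i) (S i)) =
      mk (fun x : Σ i, κ i => lab x.1 x.2) (T.comp S) := by
  choose σ h1 h2 using fun i => exists_of_mk_eq (mk_out (mk (lab i) (S i)))
  refine mk_eq (Equiv.sigmaCongrRight σ) ?_ (Tangle.IsotopicVia.comp_right T σ h2)
  rintro ⟨i, j⟩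
  exact h1 i j

theorem act_isotopy {ι : Type} [Finite ι] {c₀ : Colour} {c : ι → Colour} {T T' : Tangle c₀ c}
    (h : T.Isotopic T') : act (col := col) T = act T' := by
  funext q
  exact mk_eq (Equiv.refl _) (fun _ => rfl) (Tangle.IsotopicVia.comp_left h _)

theorem act_reindex {ι κ : Type} [Finite ι] [Finite κ] {c₀ : Colour} {c : ι → Colour}
    (T : Tangle c₀ c) (e : κ ≃ ι) (q : ∀ i, LabelledClass col (c i)) :
    act (T.reindex e) (fun j => q (e j)) = act T q :=
  mk_eq (Equiv.sigmaCongrLeft (β := fun i => Fin (Quotient.out (q i)).boxes) e)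
    (fun _ => rfl) (Tangle.reindex_comp T e (fun i => (Quotient.out (q i)).tangle))

theorem act_comp {ι : Type} [Finite ι] {κ : ι → Type} [∀ i, Finite (κ i)] {c₀ : Colour}
    {c : ι → Colour} {d : ∀ i, κ i → Colour} (T : Tangle c₀ c) (S : ∀ i, Tangle (c i) (d i))
    (q : ∀ i j, LabelledClass col (d i j)) :
    act (T.comp S) (fun y => q y.1 y.2) = act T (fun i => act (S i) (q i)) := by
  refine Eq.trans ?_ (act_mk T
    (fun i (x : Σ j, Fin (Quotient.out (q i j)).boxes) => (Quotient.out (q i x.1)).label x.2)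
    (fun i => (S i).comp (fun j => (Quotient.out (q i j)).tangle))).symm
  exact mk_eq (Equiv.sigmaAssoc (fun i j => Fin (Quotient.out (q i j)).boxes)) (fun _ => rfl)
    (Tangle.comp_assoc T S (fun i j => (Quotient.out (q i j)).tangle))

theorem act_id (c : Colour) (q : LabelledClass col c) :
    act (idTangle c) (fun _ => q) = q := by
  conv_rhs => rw [← mk_out q]
  exact mk_eq _ (fun _ => rfl) (Tangle.id_comp _)

end LabelledClass

variable (K : Type v) [Field K]

open Classical in
/-- The multilinear extension of a map defined on basis elements. -/
def multilinearExtension {ι : Type} [Finite ι] {X : ι → Type w} {Y : Type w}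
    (g : (∀ i, X i) → Y) : MultilinearMap K (fun i => X i →₀ K) (Y →₀ K) :=
  haveI : Fintype ι := Fintype.ofFinite ι
  (Finsupp.lmapDomain K K g).compMultilinearMap
    (PiTensorProduct.ofFinsuppEquiv'.toLinearMap.compMultilinearMap (PiTensorProduct.tprod K))

theorem multilinearExtension_single {ι : Type} [Finite ι] {X : ι → Type w} {Y : Type w}
    (g : (∀ i, X i) → Y) (p : ∀ i, X i) :
    multilinearExtension K g (fun i => Finsupp.single (p i) 1) = Finsupp.single (g p) 1 := by
  classical
  have : Fintype ι := Fintype.ofFinite ι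
  unfold multilinearExtension
  simp only [LinearMap.compMultilinearMap_apply, LinearEquiv.coe_coe,
    PiTensorProduct.ofFinsuppEquiv'_tprod_single, Finsupp.lmapDomain_apply,
    Finsupp.mapDomain_single, Finset.prod_const_one]

theorem multilinear_ext {ι : Type} [Finite ι] {X : ι → Type w} {V : Type*} [AddCommGroup V]
    [Module K V] {f g : MultilinearMap K (fun i => X i →₀ K) V}
    (h : ∀ p : ∀ i, X i, f (fun i => Finsupp.single (p i) 1) =
      g (fun i => Finsupp.single (p i) 1)) : f = g := by
  refine Module.Basis.ext_multilinear (fun _ => Finsupp.basisSingleOne) fun p => ?_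
  simpa using h p

/-- Renumbering of the variables of a multilinear map. -/
def renumberMap {ι κ : Type} {M : ι → Type*} [∀ i, AddCommGroup (M i)] [∀ i, Module K (M i)]
    {V : Type*} [AddCommGroup V] [Module K V] (e : κ ≃ ι)
    (f : MultilinearMap K (fun j => M (e j)) V) : MultilinearMap K M V where
  toFun x := f (fun j => x (e j))
  map_update_add' := by
    intro _ x i a b
    classical
    obtain ⟨j, rfl⟩ := e.surjective i
    have h : ∀ a : M (e j), (fun k => Function.update x (e j) a (e k)) =
        Function.update (fun k => x (e k)) j a := by
      intro a
      funext k
      by_cases hk : k = j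
      · subst hk; simp
      · have : e k ≠ e j := fun h => hk (e.injective h)
        simp [hk, this]
    rw [h, h, h, MultilinearMap.map_update_add]
  map_update_smul' := by
    intro _ x i a b
    classical
    obtain ⟨j, rfl⟩ := e.surjective i
    have h : ∀ a : M (e j), (fun k => Function.update x (e j) a (e k)) =
        Function.update (fun k => x (e k)) j a := by
      intro a
      funext k
      by_cases hk : k = j
      · subst hk; simp
      · have : e k ≠ e j := fun h => hk (e.injective h)
        simp [hk, this]
    rw [h, h, MultilinearMap.map_update_smul]

attribute [irreducible] multilinearExtension

theorem multilinearExtension_comp {ι : Type} [Finite ι] {κ : ι → Type} [∀ i, Finite (κ i)]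
    {X : ∀ i, κ i → Type w} {Y : ι → Type w} {W : Type w} (g : (∀ i, Y i) → W)
    (f : ∀ i, (∀ j, X i j) → Y i) (x : ∀ i j, X i j →₀ K) :
    multilinearExtension K
      (fun p : (∀ y : Σ i, κ i, X y.1 y.2) => g (fun i => f i (fun j => p ⟨i, j⟩)))
      (fun y => x y.1 y.2) =
    multilinearExtension K g (fun i => multilinearExtension K (f i) (x i)) := by
  have : multilinearExtension K
      (fun p : (∀ y : Σ i, κ i, X y.1 y.2) => g (fun i => f i (fun j => p ⟨i, j⟩))) =
      (multilinearExtension K g).compMultilinearMap (fun i => multilinearExtension K (f i)) := by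
    refine multilinear_ext K fun p => ?_
    rw [multilinearExtension_single]
    change _ = multilinearExtension K g
      (fun i => multilinearExtension K (f i) (fun j => Finsupp.single (p ⟨i, j⟩) 1))
    simp only [multilinearExtension_single]
  exact congrArg (fun f => f (fun y => x y.1 y.2)) this

theorem multilinearExtension_renumber {ι κ : Type} [Finite ι] [Finite κ] (e : κ ≃ ι)
    {X : ι → Type w} {W : Type w} (g : (∀ j, X (e j)) → W) (x : ∀ i, X i →₀ K) :
    multilinearExtension K g (fun j => x (e j)) =
      multilinearExtension K (fun p : ∀ i, X i => g (fun j => p (e j))) x := by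
  have : renumberMap K e (multilinearExtension K g) =
      multilinearExtension K (fun p : ∀ i, X i => g (fun j => p (e j))) := by
    refine multilinear_ext K fun p => ?_
    rw [multilinearExtension_single]
    exact multilinearExtension_single K _ (fun j => p (e j))
  exact congrArg (fun f => f x) this

theorem multilinearExtension_unit {X : Type w} (g : (Unit → X) → X)
    (hg : ∀ q, g (fun _ => q) = q) (x : X →₀ K) :
    multilinearExtension K g (fun _ => x) = x := by
  have h : ∀ y, (multilinearExtension K g).toLinearMap (fun _ => 0) () y =
      multilinearExtension K g (fun _ => y) := fun y => by
    rw [MultilinearMap.toLinearMap_apply]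
    congr 1
  have h2 : (multilinearExtension K g).toLinearMap (fun _ => 0) () = LinearMap.id := by
    refine Finsupp.lhom_ext' fun q => LinearMap.ext_ring ?_
    simp only [LinearMap.comp_apply, Finsupp.lsingle_apply, LinearMap.id_apply]
    rw [h, multilinearExtension_single, hg]
  rw [← h, h2, LinearMap.id_apply]

/-- The universal planar algebra on a label set: in each colour, the vector space with basis the
labelled tangles of this colour; tangles act by substitution. -/
def universalPlanarAlgebra : PlanarAlgebra.{max v w} K where
  space c := LabelledClass col c →₀ K
  Z T := multilinearExtension K (LabelledClass.act T)
  isotopy T T' h := by rw [LabelledClass.act_isotopy h]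
  renumber T e x := by
    refine (multilinearExtension_renumber K e (LabelledClass.act (T.reindex e)) x).trans ?_
    congr 1
    congr 1
    exact funext fun p => LabelledClass.act_reindex T e p
  substitute T S x := by
    rw [← multilinearExtension_comp]
    congr 1
    congr 1
    exact funext fun p => LabelledClass.act_comp T S (fun i j => p ⟨i, j⟩)
  identity c x := multilinearExtension_unit K _ (LabelledClass.act_id c) x

end universal

end

/-! The argument is the classical one that finite presentability does not depend on the finite
generating set chosen. It rests on P(L) being free on its labels. Write `of l` for the tangle
consisting of one box labelled l, joined straight to the external box. Any choice of values for the
`of l` in a planar algebra Q extends to a morphism P(L) → Q (`lift`). Moreover, two morphisms that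
agree on the `of l` modulo a planar ideal agree modulo it everywhere (`sub_mem`).

Freeness and surjectivity of the two presentations give morphisms φ : P(L) → P(L') and ψ : P(L') →
P(L) with π'φ = π and πψ = π' (`exists_lift`). Let R be a finite set generating ker π, and let J be
the ideal of P(L') generated by φ(R) and by the finitely many elements l - φψ(l), for l in L'. All
these elements are killed by π', so J ⊆ ker π'. Conversely, φψ is congruent to the identity modulo
J, because it is so on generators. If π'(x) = 0, then ψ(x) lies in ker π, which R generates, so
φψ(x) lies in J, and hence so does x. This is `ker_fg_of_ker_fg`; exchanging the presentations gives
the equivalence.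

The geometric input is that every basis element of P(L) is a tangle applied to generators. This
means that plugging identity tangles into all the boxes of T returns T up to isotopy
(`Tangle.comp_id`). The required homeomorphism is supported in slightly enlarged boxes: it stretches
each half-size box to full size and compresses the surrounding collar, where all strings are radial.
-/

noncomputable section

universe u v w z

/-! ### Geometry: identity tangles are neutral when substituted into the boxes of a tangle -/

/-- The centers of disjoint closed round discs are further apart than the sum of the radii. -/
theorem Box.add_lt_norm_sub {B B' : Box}
    (h : ∀ z w, ‖z‖ ≤ 1 → ‖w‖ ≤ 1 → B.map z ≠ B'.map w) :
    ‖B.scale‖ + ‖B'.scale‖ < ‖B'.center - B.center‖ := by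
  by_contra! hle
  have h1 := norm_pos_iff.2 B.scale_ne
  have h2 := norm_pos_iff.2 B'.scale_ne
  set s := ‖B.scale‖ + ‖B'.scale‖ with hs
  have hs0 : 0 < s := by positivity
  have hs0' : (s : ℂ) ≠ 0 := by exact_mod_cast hs0.ne'
  -- If the discs were not far apart, the point dividing the segment between the centers in the
  -- ratio of the radii would lie in both. Its coordinate in either box has norm equal to the
  -- distance of the centers divided by `s`. The coordinate in `B'` carries a minus sign, as that
  -- center is approached from the other side.
  have key : ∀ b : ℂ, b ≠ 0 →
      ‖b⁻¹ * ((‖b‖ / s : ℝ) : ℂ) * (B'.center - B.center)‖ ≤ 1 := by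
    intro b hb
    have hb' : ‖b‖ ≠ 0 := by simpa using hb
    rw [norm_mul, norm_mul, Complex.norm_real, norm_inv, Real.norm_of_nonneg (by positivity)]
    have : ‖b‖⁻¹ * (‖b‖ / s) = s⁻¹ := by field_simp
    rw [this, inv_mul_le_iff₀ hs0, mul_one]
    exact hle
  refine h _ (-(B'.scale⁻¹ * ((‖B'.scale‖ / s : ℝ) : ℂ) * (B'.center - B.center)))
    (key _ B.scale_ne) (by rw [norm_neg]; exact key _ B'.scale_ne) ?_
  simp only [Box.map, mul_neg, mul_assoc, mul_inv_cancel_left₀ B.scale_ne,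
    mul_inv_cancel_left₀ B'.scale_ne]
  have : ((‖B.scale‖ / s : ℝ) : ℂ) + ((‖B'.scale‖ / s : ℝ) : ℂ) = 1 := by
    rw [← Complex.ofReal_add, ← add_div, div_self hs0.ne', Complex.ofReal_one]
  linear_combination (B'.center - B.center) * this

namespace Tangle

/-- The internal boxes of a tangle remain disjoint when they are slightly enlarged. -/
theorem eventually_enlarged_disjoint {ι : Type} [Finite ι] {c₀ : Colour} {c : ι → Colour}
    (T : Tangle c₀ c) : ∀ᶠ r : ℝ in 𝓝[≥] (1 : ℝ), ∀ i j, i ≠ j → ∀ z w : ℂ, ‖z‖ ≤ r → ‖w‖ ≤ r →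
      (T.box i).map z ≠ (T.box j).map w := by
  refine Filter.eventually_all.2 fun i => Filter.eventually_all.2 fun j => ?_
  by_cases hij : i = j
  · exact Eventually.of_forall fun r h => (h hij).elim
  have hlt := Box.add_lt_norm_sub (T.box_disjoint i j hij)
  -- The inequality between the sum of the radii and the distance of the centers is strict, so it
  -- survives multiplying both radii by some `r` close to 1. A common point of the enlarged discs
  -- would then contradict the triangle inequality.
  have ht : Tendsto (fun r : ℝ => r * (‖(T.box i).scale‖ + ‖(T.box j).scale‖)) (𝓝 1)
      (𝓝 (1 * (‖(T.box i).scale‖ + ‖(T.box j).scale‖))) := tendsto_id.mul_const _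
  rw [one_mul] at ht
  refine mem_nhdsWithin_of_mem_nhds ?_
  filter_upwards [ht.eventually (gt_mem_nhds hlt)] with r hr _ z w hz hw h
  have e : (T.box j).center - (T.box i).center = (T.box i).scale * z - (T.box j).scale * w := by
    simp only [Box.map] at h
    linear_combination -h
  have h1 := norm_sub_le ((T.box i).scale * z) ((T.box j).scale * w)
  rw [← e, norm_mul, norm_mul] at h1
  nlinarith [norm_nonneg (T.box i).scale, norm_nonneg (T.box j).scale]

/-- Stretching the disc of radius `1 / 2` to the unit disc, inside the disc of radius `ρ`, carries a
set that is radial between radii `1 / 2` and `ρ` to one that is radial between `1` and `ρ`. -/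
theorem expand_iff {ρ : ℝ} (hρ : 1 < ρ) {f : ℝ ≃o ℝ} {hf : f 0 = 0}
    (hlow : ∀ r, r ≤ ρ⁻¹ / 2 → f r = 2 * r) (hhigh : ∀ r, 1 ≤ r → f r = r) {X Y A : Set ℂ}
    (hX : ∀ r : ℝ, 1 ≤ r → r ≤ ρ → ∀ z : ℂ, ‖z‖ = 1 → (r * z ∈ X ↔ z ∈ A))
    (hX1 : ∀ q, ‖q‖ < 1 → q ∉ X) (hin : ∀ q, ‖q‖ ≤ 1 → (q ∈ Y ↔ q ∈ radial A))
    (hout : ∀ q, 1 ≤ ‖q‖ → ‖q‖ ≤ ρ → (q ∈ Y ↔ q ∈ X)) {z : ℂ} (hz : ‖z‖ ≤ 1) :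
    ρ * radialHomeo f hf z ∈ X ↔ ρ * z ∈ Y := by
  have hρ0 : 0 < ρ := by linarith
  have hn : ‖(ρ : ℂ) * z‖ = ρ * ‖z‖ := by
    rw [norm_mul, Complex.norm_real, Real.norm_of_nonneg hρ0.le]
  have hρi : ρ * ρ⁻¹ = 1 := mul_inv_cancel₀ hρ0.ne'
  -- Here `f` doubles radii, and both sides are empty: `ρ * z` has norm less than 1/2, inside the
  -- hole of `radial A`, while its double has norm less than 1, where `X` has no points.
  rcases lt_or_ge ‖z‖ (ρ⁻¹ / 2) with h | h
  · have h1 : ρ * ‖z‖ < 1 / 2 := by nlinarith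
    have e : radialHomeo f hf z = 2 * z := by
      rw [radialHomeo_apply, hlow _ h.le]
      by_cases hz0 : z = 0
      · simp [hz0]
      · rw [Complex.ofReal_mul, mul_assoc, (norm_mul_div_norm hz0).1]; simp
    have h2 : ‖(ρ : ℂ) * (2 * z)‖ < 1 := by
      rw [mul_left_comm, norm_mul, hn, Complex.norm_ofNat]; linarith
    rw [e, hin _ (by linarith)]
    exact ⟨fun h3 => (hX1 _ h2 h3).elim, fun h3 => by have := h3.1; linarith⟩
  -- From radius ρ⁻¹/2 on, `f` takes values between ρ⁻¹ and 1. After scaling by ρ the image lies in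
  -- the collar where `X` is radial, so only the direction `z / ‖z‖` matters. The same holds for `Y`
  -- at `ρ * z`: inside the unit disc it is `radial A`, and outside it is `X`.
  · have hz0 : z ≠ 0 := by
      rintro rfl
      rw [norm_zero] at h
      have := inv_pos.2 hρ0
      linarith
    obtain ⟨e1, e2⟩ := norm_mul_div_norm hz0
    have h1 : ρ⁻¹ ≤ f ‖z‖ := by
      have := f.monotone h
      rw [hlow _ le_rfl] at this
      linarith
    have h2 : f ‖z‖ ≤ 1 := by
      have := f.monotone hz
      rwa [hhigh _ le_rfl] at this
    have e3 : (ρ : ℂ) * z = ((ρ * ‖z‖ : ℝ) : ℂ) * (z / ‖z‖) := by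
      rw [Complex.ofReal_mul, mul_assoc, e1]
    rw [radialHomeo_apply, ← mul_assoc, ← Complex.ofReal_mul,
      hX _ (by nlinarith) (by nlinarith) _ e2]
    rcases le_total (ρ * ‖z‖) 1 with h3 | h3
    · rw [hin _ (hn.trans_le h3), e3, mul_mem_radial e2 (by nlinarith) h3]
    · rw [hout _ (h3.trans_eq hn.symm) (by rw [hn]; nlinarith), e3, hX _ h3 (by nlinarith) _ e2]

/-- Substitution of identity tangles. -/
theorem comp_id {ι : Type} [Finite ι] {c₀ : Colour} {c : ι → Colour} (T : Tangle c₀ c) :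
    IsotopicVia (Equiv.sigmaUnique ι (fun _ => Unit)) (T.comp (fun i => idTangle (c i))) T := by
  -- Conditions on an enlargement factor: the enlarged boxes are disjoint and stay in the open
  -- external disc, and strings and shading are radial in the collars added to the boxes.
  have hev : ∀ᶠ r : ℝ in 𝓝[≥] (1 : ℝ),
      (∀ i j, i ≠ j → ∀ z w : ℂ, ‖z‖ ≤ r → ‖w‖ ≤ r → (T.box i).map z ≠ (T.box j).map w) ∧
      (∀ i, ∀ z : ℂ, ‖z‖ = 1 → ((T.box i).map (r * z) ∈ T.curves ↔ z ∈ (c i).marked)) ∧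
      (∀ i, ∀ z : ℂ, ‖z‖ = 1 → ((T.box i).map (r * z) ∈ T.black ↔ z ∈ (c i).blackArc)) ∧
      ∀ i, ∀ z : ℂ, ‖z‖ = 1 → ‖(T.box i).map (r * z)‖ < 1 :=
    T.eventually_enlarged_disjoint.and ((Filter.eventually_all.2 T.inner_curves).and
      ((Filter.eventually_all.2 T.inner_black).and (Filter.eventually_all.2 T.eventually_inside)))
  obtain ⟨l, hl, hl'⟩ := mem_nhdsGE_iff_exists_Ico_subset.1 hev
  have hl : 1 < l := hl
  -- The midpoint makes the whole closed range from 1 to ρ admissible, which the homeomorphism of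
  -- the closed enlarged boxes needs.
  set ρ := (l + 1) / 2 with hρ
  have h1 : 1 < ρ := by linarith
  have hr : ∀ r, 1 ≤ r → r ≤ ρ → r ∈ Ico 1 l := fun r h1 h2 => ⟨h1, by linarith⟩
  have hρ0 : 0 < ρ := by linarith
  have hρi : ρ * ρ⁻¹ = 1 := mul_inv_cancel₀ hρ0.ne'
  have hρc : (ρ : ℂ) ≠ 0 := by exact_mod_cast hρ0.ne'
  have hnρ : ∀ z : ℂ, ‖(ρ : ℂ) * z‖ = ρ * ‖z‖ := fun z => by
    rw [norm_mul, Complex.norm_real, Real.norm_of_nonneg hρ0.le]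
  -- The parameter is ρ⁻¹ because, in the coordinate of an enlarged box, the original box has radius
  -- ρ⁻¹ and the box of the inserted identity tangle has radius ρ⁻¹/2. Thus `f` stretches the latter
  -- onto the former and is the identity from the boundary of the enlarged box outwards.
  obtain ⟨f, hlow, hhigh⟩ := exists_stretch (inv_pos.2 hρ0) (inv_lt_one_of_one_lt₀ h1)
  have hf : f 0 = 0 := by rw [hlow 0 (by have := inv_pos.2 hρ0; linarith)]; simp
  let E : ι → Box := fun i => (T.box i).comp ⟨0, ρ, hρc⟩
  have hE : ∀ i z, (E i).map z = (T.box i).map (ρ * z) := fun i z => by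
    rw [Box.comp_map]; simp [Box.map]
  obtain ⟨G, hG1, hG2⟩ := exists_glue E (by
      intro i j hij z w hz hw
      rw [hE, hE]
      refine (hl' (hr ρ h1.le le_rfl)).1 i j hij _ _ ?_ ?_
      · rw [hnρ]; nlinarith
      · rw [hnρ]; nlinarith)
    (fun _ => radialHomeo f hf) (by
      intro _ z hz
      have hz0 : z ≠ 0 := by rintro rfl; norm_num at hz
      rw [radialHomeo_apply, hhigh _ hz, (norm_mul_div_norm hz0).1])
  -- `G` is known off the open enlarged boxes and on the closed ones. These sets cover the plane, so
  -- the checks below split along them.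
  have key : ∀ p, (∀ i z, ‖z‖ < 1 → (E i).map z ≠ p) ∨ ∃ i z, ‖z‖ ≤ 1 ∧ (E i).map z = p := by
    intro p
    by_contra! h
    obtain ⟨⟨i, z, hz, hz'⟩, h⟩ := h
    exact h i z hz.le hz'
  have hout : ∀ p, (∀ i z, ‖z‖ < 1 → (E i).map z ≠ p) →
      ∀ i z, ‖z‖ < 1 → (T.box i).map z ≠ p := by
    rintro p hp i z hz rfl
    refine hp i ((ρ : ℂ)⁻¹ * z) ?_ ?_
    · rw [norm_mul, norm_inv, Complex.norm_real, Real.norm_of_nonneg hρ0.le]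
      nlinarith [norm_nonneg z, inv_lt_one_of_one_lt₀ h1]
    · rw [hE, mul_inv_cancel_left₀ hρc]
  -- The collar of one box meets no open box: not its own by the norm, and no other by disjointness
  -- of the enlargements. Hence the substitution leaves `T` unchanged on the collar.
  have hout' : ∀ i q, 1 ≤ ‖q‖ → ‖q‖ ≤ ρ → ∀ j z, ‖z‖ < 1 → (T.box j).map z ≠ (T.box i).map q := by
    intro i q hq hq' j z hz h
    by_cases hij : j = i
    · subst hij
      rw [Box.map_inj] at h
      subst h
      linarith
    · exact (hl' (hr ρ h1.le le_rfl)).1 j i hij _ _ (by linarith) hq' h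
  refine isotopicVia_iff.2 ⟨G, ?_, ?_, ?_, ?_⟩
  -- The enlarged boxes lie in the open unit disc: the original box by `norm_box_lt`, its collar by
  -- the choice of ρ. Therefore `G` fixes everything else.
  · intro p hp
    refine hG2 p ?_
    rintro i z hz rfl
    rw [hE] at hp
    refine hp.not_gt ?_
    rcases le_total (ρ * ‖z‖) 1 with h2 | h2
    · exact T.norm_box_lt i ((hnρ z).trans_le h2)
    · have hz0 : z ≠ 0 := by rintro rfl; norm_num at h2
      obtain ⟨e1, e2⟩ := norm_mul_div_norm hz0
      have := (hl' (hr (ρ * ‖z‖) h2 (by nlinarith))).2.2.2 i _ e2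
      rwa [Complex.ofReal_mul, mul_assoc, e1] at this
  · rintro ⟨i, ⟨⟩⟩ z hz
    change G (((T.box i).comp halfBox).map z) = (T.box i).map z
    -- Seen from the enlarged box, the inserted half-size box has radius ρ⁻¹/2, so it lies in the
    -- range where `f` is exactly doubling. This makes `G` a similarity there, as `Carries` demands.
    have e : ((T.box i).comp halfBox).map z = (E i).map ((ρ : ℂ)⁻¹ * halfBox.map z) := by
      rw [hE, mul_inv_cancel_left₀ hρc, Box.comp_map]
    have hn : ‖(ρ : ℂ)⁻¹ * halfBox.map z‖ = ρ⁻¹ * (1 / 2 * ‖z‖) := by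
      rw [norm_mul, norm_inv, Complex.norm_real, Real.norm_of_nonneg hρ0.le, norm_halfBox_map]
    have h2 := inv_pos.2 hρ0
    have h3 : ρ⁻¹ * (1 / 2 * ‖z‖) ≤ ρ⁻¹ / 2 := by nlinarith
    rw [e, hG1 _ _ (by rw [hn]; linarith [inv_lt_one_of_one_lt₀ h1]), hE]
    congr 1
    by_cases hz0 : z = 0
    · simp [hz0, halfBox_map, radialHomeo_apply]
    have hw0 : (ρ : ℂ)⁻¹ * halfBox.map z ≠ 0 := by
      rw [halfBox_map]; simp [hz0, hρ0.ne']
    rw [radialHomeo_apply, hlow _ (by rw [hn]; exact h3), Complex.ofReal_mul, mul_assoc,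
      (norm_mul_div_norm hw0).1, halfBox_map]
    push_cast
    field_simp
  · intro p
    rcases key p with hp | ⟨i, z, hz, rfl⟩
    · rw [hG2 p hp]
      exact (T.glue_curves_out _ (hout p hp)).symm
    · rw [hG1 i z hz, hE, hE]
      -- Both curve sets are pulled back to the coordinate of the box `i`, in which the substituted
      -- tangle is radial up to the unit circle and agrees with `T` beyond it.
      exact expand_iff h1 hlow hhigh (X := (T.box i).map ⁻¹' T.curves)
        (Y := (T.box i).map ⁻¹' (T.comp fun i => idTangle (c i)).curves) (A := (c i).marked)
        (fun r a b => (hl' (hr r a b)).2.1 i) (T.curves_outside i)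
        (fun q hq => T.glue_curves_in (fun i => idTangle (c i)) hq)
        (fun q hq hq' => T.glue_curves_out (fun i => idTangle (c i)) (hout' i q hq hq')) hz
  · intro p
    rcases key p with hp | ⟨i, z, hz, rfl⟩
    · rw [hG2 p hp]
      exact (T.glue_black_out _ (hout p hp)).symm
    · rw [hG1 i z hz, hE, hE]
      exact expand_iff h1 hlow hhigh (X := (T.box i).map ⁻¹' T.black)
        (Y := (T.box i).map ⁻¹' (T.comp fun i => idTangle (c i)).black) (A := (c i).blackArc)
        (fun r a b => (hl' (hr r a b)).2.2.1 i)
        (fun q hq h => (T.black_subset h).2.2 i q hq rfl)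
        (fun q hq => T.glue_black_in (fun i => idTangle (c i)) hq)
        (fun q hq hq' => T.glue_black_out (fun i => idTangle (c i)) (hout' i q hq hq')) hz

end Tangle

/-! ### Invariance of the action, and congruence modulo a planar ideal -/

namespace PlanarAlgebra

variable {K : Type v} [Field K]

/-- This combines the isotopy and renumbering axioms. `IsotopicVia` does not record colours, and for
labelled tangles the colours of matching boxes agree only propositionally, so inputs in different
fibres are compared by `HEq`. Once the colour functions are identified, `T` is isotopic to the
renumbered `T'`. -/
theorem Z_isotopicVia (P : PlanarAlgebra.{u} K) {ι κ : Type} [Finite ι] [Finite κ] {c₀ : Colour}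
    {c : ι → Colour} {d : κ → Colour} {σ : ι ≃ κ} {T : Tangle c₀ c} {T' : Tangle c₀ d}
    (h : Tangle.IsotopicVia σ T T') (hc : ∀ i, c i = d (σ i)) (x : ∀ i, P.space (c i))
    (y : ∀ j, P.space (d j)) (hxy : ∀ i, HEq (x i) (y (σ i))) : P.Z T x = P.Z T' y := by
  obtain rfl : c = fun i => d (σ i) := funext hc
  obtain rfl : x = fun i => y (σ i) := funext fun i => eq_of_heq (hxy i)
  rw [← P.renumber T' σ y]
  have h' : T.Isotopic (T'.reindex σ) := by
    have := h.trans (Tangle.isotopicVia_reindex T' σ).symm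
    rwa [Equiv.self_trans_symm] at this
  rw [P.isotopy _ _ h']

namespace PlanarIdeal

variable {P : PlanarAlgebra.{u} K}

theorem mem_span {R : Set (Σ c, P.space c)} {c : Colour} {x : P.space c} :
    x ∈ (span P R).carrier c ↔
      ∀ J : PlanarIdeal P, (∀ r ∈ R, r.2 ∈ J.carrier r.1) → x ∈ J.carrier c := by
  unfold span
  simp only [Submodule.mem_sInf]
  exact ⟨fun h J hJ => h _ ⟨J, hJ, rfl⟩, by rintro h _ ⟨J, hJ, rfl⟩; exact h J hJ⟩

theorem subset_span {R : Set (Σ c, P.space c)} {r : Σ c, P.space c} (hr : r ∈ R) :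
    r.2 ∈ (span P R).carrier r.1 :=
  mem_span.2 fun _ hJ => hJ r hr

/-- Inputs that are congruent modulo a planar ideal have congruent outputs. -/
theorem Z_sub_Z_mem (J : PlanarIdeal P) {ι : Type} [Finite ι] {c₀ : Colour} {c : ι → Colour}
    (T : Tangle c₀ c) (x y : ∀ i, P.space (c i)) (h : ∀ i, x i - y i ∈ J.carrier (c i)) :
    P.Z T x - P.Z T y ∈ J.carrier c₀ := by
  classical
  cases nonempty_fintype ι
  -- The inputs are exchanged one at a time: those in `s` have already been changed from `y` to `x`.
  suffices hs : ∀ s : Finset ι, P.Z T (s.piecewise x y) - P.Z T y ∈ J.carrier c₀ by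
    simpa using hs Finset.univ
  intro s
  induction s using Finset.induction_on with
  | empty => simp
  | insert a s ha ih =>
    -- With both input families written as updates at `a`, multilinearity turns the difference of
    -- outputs into a single output whose input at `a` is `x a - y a`, an element of `J`.
    have hy : s.piecewise x y = Function.update (s.piecewise x y) a (y a) := by
      rw [eq_comm, Function.update_eq_self_iff, Finset.piecewise_eq_of_notMem _ _ _ ha]
    have h1 : P.Z T ((insert a s).piecewise x y) - P.Z T (s.piecewise x y) ∈ J.carrier c₀ := by
      rw [Finset.piecewise_insert]
      nth_rewrite 2 [hy]
      rw [← MultilinearMap.map_update_sub]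
      refine J.absorb T _ a ?_
      rw [Function.update_self]
      exact h a
    simpa using (J.carrier c₀).add_mem h1 ih

/-- The preimage of a planar ideal. -/
def comap {Q : PlanarAlgebra.{w} K} (f : Hom P Q) (J : PlanarIdeal Q) : PlanarIdeal P where
  carrier c := (J.carrier c).comap (f.toFun c)
  absorb T x i hi := by
    rw [Submodule.mem_comap, f.map_Z]
    exact J.absorb T _ i hi

end PlanarIdeal

end PlanarAlgebra

/-! ### Evaluation of labelled tangles in a planar algebra -/

namespace LabelledClass

variable {K : Type v} [Field K] {L : Type w} {col : L → Colour}

/-- The value of a labelled tangle in a planar algebra in which the labels are interpreted. -/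
def eval (Q : PlanarAlgebra.{u} K) (a : ∀ l, Q.space (col l)) {c₀ : Colour}
    (q : LabelledClass col c₀) : Q.space c₀ :=
  Quotient.liftOn q (fun x => Q.Z x.tangle (fun i => a (x.label i))) fun _ _ ⟨_, h1, h2⟩ =>
    Q.Z_isotopicVia h2 (fun i => by rw [h1]) _ _ (fun i => by rw [h1])

/-- The renumbering axiom of `Q` undoes the arbitrary numbering of the boxes built into `mk`. -/
theorem eval_mk (Q : PlanarAlgebra.{u} K) (a : ∀ l, Q.space (col l)) {κ : Type} [Finite κ]
    {c₀ : Colour} (lab : κ → L) (T : Tangle c₀ (fun i => col (lab i))) :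
    eval Q a (mk lab T) = Q.Z T (fun i => a (lab i)) :=
  Q.renumber T (Finite.equivFin κ).symm (fun i => a (lab i))

/-- This is the substitution axiom of `Q`. As `act` glues chosen representatives, the inputs are
first evaluated on those same representatives. It is the basis case of the compatibility of `lift`
with tangles. -/
theorem eval_act (Q : PlanarAlgebra.{u} K) (a : ∀ l, Q.space (col l)) {ι : Type} [Finite ι]
    {c₀ : Colour} {c : ι → Colour} (T : Tangle c₀ c) (q : ∀ i, LabelledClass col (c i)) :
    eval Q a (act T q) = Q.Z T (fun i => eval Q a (q i)) := by
  have h : (fun i => eval Q a (q i)) = fun i =>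
      Q.Z (Quotient.out (q i)).tangle (fun j => a ((Quotient.out (q i)).label j)) := by
    funext i
    conv_lhs => rw [← mk_out (q i)]
    exact eval_mk Q a _ _
  rw [h, ← Q.substitute]
  exact eval_mk Q a _ _

/-- The class of a single box with a given label. -/
def gen (l : L) : LabelledClass col (col l) :=
  mk (fun _ : Unit => l) (idTangle (col l))

theorem eval_gen (Q : PlanarAlgebra.{u} K) (a : ∀ l, Q.space (col l)) (l : L) :
    eval Q a (gen l) = a l :=
  (eval_mk Q a _ _).trans (Q.identity _ _)

/-- Inserting generators means substituting identity tangles, so `Tangle.comp_id` applies. This is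
why the single boxes generate. -/
theorem act_gen {κ : Type} [Finite κ] {c₀ : Colour} (lab : κ → L)
    (T : Tangle c₀ (fun i => col (lab i))) : act T (fun i => gen (lab i)) = mk lab T :=
  (act_mk T (fun i (_ : Unit) => lab i) (fun i => idTangle (col (lab i)))).trans
    (mk_eq _ (fun _ => rfl) T.comp_id)

end LabelledClass

/-! ### The universal property of P(L) -/

namespace universalPlanarAlgebra

open PlanarAlgebra LabelledClass

variable {K : Type v} [Field K] {L : Type w} {col : L → Colour}

/-- The generator of the universal planar algebra that belongs to a label. -/
def of (l : L) : (universalPlanarAlgebra col K).space (col l) :=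
  (Finsupp.single (gen l) 1 : LabelledClass col (col l) →₀ K)

/-- Every basis vector is thus the output of a tangle on generators, which reduces statements about
morphisms out of P(L) to the labels. -/
theorem Z_of {κ : Type} [Finite κ] {c₀ : Colour} (lab : κ → L)
    (T : Tangle c₀ (fun i => col (lab i))) :
    (universalPlanarAlgebra col K).Z T (fun i => of (lab i)) =
      (Finsupp.single (mk lab T) 1 : LabelledClass col c₀ →₀ K) := by
  rw [← act_gen lab T]
  exact multilinearExtension_single K (act T) (fun i => gen (lab i))

/-- The morphism from the universal planar algebra with given values on the generators. -/
def lift (Q : PlanarAlgebra.{u} K) (a : ∀ l, Q.space (col l)) :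
    (universalPlanarAlgebra col K).Hom Q where
  toFun c := Finsupp.linearCombination K (fun q : LabelledClass col c => eval Q a q)
  map_Z {ι} _ c₀ c T x := by
    -- Both sides of the compatibility are multilinear in the inputs, so basis vectors suffice.
    have h : (Finsupp.linearCombination K
          (fun q : LabelledClass col c₀ => eval Q a q)).compMultilinearMap
          (multilinearExtension K (act T)) =
        (Q.Z T).compLinearMap
          (fun i => Finsupp.linearCombination K (fun q : LabelledClass col (c i) => eval Q a q)) := by
      refine multilinear_ext K fun p => ?_
      rw [LinearMap.compMultilinearMap_apply, multilinearExtension_single,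
        MultilinearMap.compLinearMap_apply]
      simp only [Finsupp.linearCombination_single, one_smul]
      exact eval_act Q a T p
    exact congrArg (fun f => f x) h

theorem lift_of (Q : PlanarAlgebra.{u} K) (a : ∀ l, Q.space (col l)) (l : L) :
    (lift Q a).toFun (col l) (of l) = a l :=
  (Finsupp.linearCombination_single K 1 (gen l)).trans ((one_smul K _).trans (eval_gen Q a l))

/-- Two morphisms from the universal planar algebra that are congruent modulo a planar ideal on the
generators are congruent. -/
theorem sub_mem {Q : PlanarAlgebra.{u} K} (J : PlanarIdeal Q)
    (f g : (universalPlanarAlgebra col K).Hom Q)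
    (h : ∀ l, f.toFun _ (of l) - g.toFun _ (of l) ∈ J.carrier (col l)) {c : Colour}
    (x : (universalPlanarAlgebra col K).space c) : f.toFun c x - g.toFun c x ∈ J.carrier c := by
  -- The elements on which `f` and `g` are congruent form a subspace, so it is enough to treat basis
  -- vectors.
  suffices hs : ∀ y : LabelledClass col c →₀ K,
      y ∈ (J.carrier c).comap (f.toFun c - g.toFun c) from hs x
  intro y
  induction y using Finsupp.induction_linear with
  | zero => exact Submodule.zero_mem _
  | add y z hy hz => exact Submodule.add_mem _ hy hz
  | single q k =>
    have hq : (Finsupp.single q k : LabelledClass col c →₀ K) = k • Finsupp.single q 1 := by simp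
    rw [hq]
    refine Submodule.smul_mem _ k ?_
    -- The basis vector becomes a tangle applied to generators. Both morphisms pass through the
    -- tangle, and the inputs are congruent by hypothesis.
    rw [← mk_out q, ← Z_of]
    change f.toFun c _ - g.toFun c _ ∈ J.carrier c
    rw [f.map_Z, g.map_Z]
    exact J.Z_sub_Z_mem _ _ _ fun i => h _

end universalPlanarAlgebra

/-! ### Comparison of two presentations -/

namespace PlanarAlgebra

variable {K : Type v} [Field K]

/-- The identity morphism. -/
def Hom.id (P : PlanarAlgebra.{u} K) : P.Hom P where
  toFun _ := LinearMap.id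
  map_Z _ _ := rfl

/-- Composition of morphisms. -/
def Hom.comp {P : PlanarAlgebra.{u} K} {Q : PlanarAlgebra.{w} K} {R : PlanarAlgebra.{z} K}
    (g : Q.Hom R) (f : P.Hom Q) : P.Hom R where
  toFun c := (g.toFun c).comp (f.toFun c)
  map_Z T x := by
    rw [LinearMap.comp_apply, f.map_Z, g.map_Z]
    rfl

end PlanarAlgebra

open PlanarAlgebra universalPlanarAlgebra

/-- Morphisms out of a universal planar algebra lift along surjective morphisms. -/
theorem exists_lift {K : Type v} [Field K] {P : PlanarAlgebra.{u} K} {L : Type w}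
    {col : L → Colour} {Q : PlanarAlgebra.{z} K} (π : (universalPlanarAlgebra col K).Hom P)
    (π' : Q.Hom P) (hπ' : π'.Surjective) : ∃ φ : (universalPlanarAlgebra col K).Hom Q,
      ∀ c x, π'.toFun c (φ.toFun c x) = π.toFun c x := by
  -- The generator of each label is sent to an arbitrary preimage of its value under `π`.
  choose a ha using fun l => hπ' (col l) (π.toFun _ (of l))
  refine ⟨lift Q a, fun c x => ?_⟩
  -- Congruence modulo the zero ideal is equality, so `sub_mem` yields uniqueness of a morphism with
  -- given values on generators.
  let Z : PlanarIdeal P := ⟨fun _ => ⊥, fun T x i hi => by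
    rw [Submodule.mem_bot] at hi ⊢
    exact MultilinearMap.map_coord_zero _ i hi⟩
  have h := sub_mem Z (π'.comp (lift Q a)) π (fun l => ?_) x
  · exact sub_eq_zero.1 ((Submodule.mem_bot K).1 h)
  · refine (Submodule.mem_bot K).2 (sub_eq_zero.2 ?_)
    change π'.toFun _ ((lift Q a).toFun _ (of l)) = _
    rw [lift_of, ha]

/-- Finite generation of the kernel of a presentation of a planar algebra passes to any other
presentation with finitely many generators. -/
theorem ker_fg_of_ker_fg {K : Type v} [Field K] {P : PlanarAlgebra.{u} K} {L : Type w}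
    {L' : Type z} [Finite L'] {col : L → Colour} {col' : L' → Colour}
    (π : (universalPlanarAlgebra col K).Hom P) (hπ : π.Surjective)
    (π' : (universalPlanarAlgebra col' K).Hom P) (hπ' : π'.Surjective) (h : π.ker.FG) :
    π'.ker.FG := by
  obtain ⟨R, hR, hspan⟩ := h
  obtain ⟨φ, hφ⟩ := exists_lift π π' hπ'
  obtain ⟨ψ, hψ⟩ := exists_lift π' π hπ
  -- Two kinds of relations are needed: the old relations transported by φ, and one relation for
  -- each label of L' that expresses its generator through the old ones. Finiteness of L' bounds the
  -- second kind.
  let S : Set (Σ c, (universalPlanarAlgebra col' K).space c) :=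
    (fun r : Σ c, (universalPlanarAlgebra col K).space c => ⟨r.1, φ.toFun r.1 r.2⟩) '' R ∪
      range fun l : L' => ⟨col' l, of l - φ.toFun _ (ψ.toFun _ (of l))⟩
  refine ⟨S, (hR.image _).union (finite_range _), ?_⟩
  ext c x
  constructor
  · intro hx
    refine PlanarIdeal.mem_span.1 hx π'.ker ?_
    rintro _ (⟨r, hr, rfl⟩ | ⟨l, rfl⟩)
    · have hr' : r.2 ∈ π.ker.carrier r.1 := hspan ▸ PlanarIdeal.subset_span hr
      exact LinearMap.mem_ker.2 ((hφ _ _).trans (LinearMap.mem_ker.1 hr'))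
    · refine LinearMap.mem_ker.2 ?_
      rw [map_sub, hφ, hψ, sub_self]
  · intro hx
    set J := PlanarIdeal.span _ S
    -- The second kind of relation says that the identity and φψ are congruent modulo `J` on
    -- generators.
    have h1 : x - φ.toFun c (ψ.toFun c x) ∈ J.carrier c :=
      sub_mem J (Hom.id _) (φ.comp ψ) (fun l => PlanarIdeal.subset_span (R := S)
        (r := ⟨col' l, of l - φ.toFun _ (ψ.toFun _ (of l))⟩) (Or.inr ⟨l, rfl⟩)) x
    have h2 : ψ.toFun c x ∈ π.ker.carrier c :=
      LinearMap.mem_ker.2 ((hψ _ _).trans (LinearMap.mem_ker.1 hx))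
    rw [← hspan] at h2
    -- The preimage of `J` under φ is a planar ideal containing `R`, so it contains all of ker π,
    -- and in particular ψ(x).
    have h3 : φ.toFun c (ψ.toFun c x) ∈ J.carrier c :=
      PlanarIdeal.mem_span.1 h2 (J.comap φ) fun r hr =>
        PlanarIdeal.subset_span (R := S) (r := ⟨r.1, φ.toFun r.1 r.2⟩) (Or.inl ⟨r, hr, rfl⟩)
    exact (sub_add_cancel x (φ.toFun c (ψ.toFun c x))) ▸ (J.carrier c).add_mem h1 h3

end

theorem proposition5p3 {K : Type*} [Field K] (P : PlanarAlgebra K)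
    {L L' : Type*} [Finite L] [Finite L'] (col : L → Colour) (col' : L' → Colour)
    (π : (universalPlanarAlgebra col K).Hom P) (hπ : π.Surjective)
    (π' : (universalPlanarAlgebra col' K).Hom P) (hπ' : π'.Surjective) :
    π.ker.FG ↔ π'.ker.FG :=
  ⟨ker_fg_of_ker_fg π hπ π' hπ', ker_fg_of_ker_fg π' hπ' π hπ⟩
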